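/- Write $e(x)=\exp(2\pi i x)$, $\zeta=\frac{1+\sqrt3\,i}{2}$, and for $a,b\in\mathbb R$, $z\in\mathbb C$, $\operatorname{Im}\tau>0$ let $$\vartheta_{a,b}(z,\tau)=\sum_{n\in\mathbb Z}\exp\bigl(\pi i(n+a)^2\tau+2\pi i(n+a)(z+b)\bigr).$$ Let $C_\zeta$ be the non-singular projective model of the curve $u^6=t^3(t-1)$, let $P_1\in C_\zeta$ be the point over $(t,u)=(1,0)$, let $\psi=\dfrac{u\,dt}{t(t-1)}$ be the holomorphic $1$-form on $C_\zeta$, and $\psi_1=\dfrac{\psi}{(1-\zeta^2)B(\frac13,\frac16)}$, where $B$ is the beta function. Let $E_\zeta=\mathbb C/L_\zeta$ with $L_\zeta=\mathbb Z\zeta+\mathbb Z$, and let $$\jmath_\zeta:C_\zeta\to E_\zeta,\qquad \jmath_\zeta(P)=\int_{P_1}^P\psi_1 \bmod L_\zeta$$ be the Abel-Jacobi map. Then $\jmath_\zeta$ is well defined (independent of the path of integration) and is an isomorphism, and the pull-back of $\psi$ under $\jmath_\zeta^{-1}$ is $$(\jmath_\zeta^{-1})^*\psi=e\bigl(-\tfrac18\bigr)\,2\pi\sqrt[4]{27}\;\vartheta_{0,0}(0,\zeta)^2\,dz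 .$$ Moreover, $$\vartheta_{0,0}(0,\zeta)=e\bigl(\tfrac1{48}\bigr)\frac{\sqrt[8]3}{\sqrt[3]4\,\pi}\Gamma\bigl(\tfrac13\bigr)^{3/2},\quad \vartheta_{0,\frac12}(0,\zeta)=e\bigl(-\tfrac1{48}\bigr)\frac{\sqrt[8]3}{\sqrt[3]4\,\pi}\Gamma\bigl(\tfrac13\bigr)^{3/2},\quad \vartheta_{\frac12,0}(0,\zeta)=e\bigl(\tfrac1{16}\bigr)\frac{\sqrt[8]3}{\sqrt[3]4\,\pi}\Gamma\bigl(\tfrac13\bigr)^{3/2},$$ $$\vartheta_{\frac13,\frac13}(0,\zeta)=e\bigl(\tfrac{11}{144}\bigr)\frac{\sqrt[8]3}{2\pi}\Gamma\bigl(\tfrac13\bigr)^{3/2},\quad \vartheta_{\frac16,\frac16}(0,\zeta)=e\bigl(\tfrac{5}{144}\bigr)\frac{\sqrt[8]{27}}{2\pi}\Gamma\bigl(\tfrac13\bigr)^{3/2},$$ $$\vartheta_{\frac56,\frac13}(0,\zeta)=e\bigl(-\tfrac{7}{144}\bigr)\frac{\sqrt[8]3}{2\pi}\Gamma\bigl(\tfrac13\bigr)^{3/2},\quad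 \vartheta_{\frac13,\frac56}(0,\zeta)=e\bigl(\tfrac{53}{144}\bigr)\frac{\sqrt[8]3}{2\pi}\Gamma\bigl(\tfrac13\bigr)^{3/2}.$$ -/

import Mathlib

open Set Topology

noncomputable section

namespace ZetaCurve

/-- `e(x) = exp(2πix)`. -/
def e (x : ℂ) : ℂ := Complex.exp (2 * Real.pi * Complex.I * x)

/-- The theta function with characteristics `a, b`:
`θ_{a,b}(z,τ) = ∑_{n ∈ ℤ} exp(πi(n+a)²τ + 2πi(n+a)(z+b))`. -/
def theta (a b : ℝ) (z τ : ℂ) : ℂ :=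
  ∑' n : ℤ, Complex.exp (Real.pi * Complex.I * ((n : ℂ) + a) ^ 2 * τ
    + 2 * Real.pi * Complex.I * ((n : ℂ) + a) * (z + b))

/-- `ζ = (1 + √3 i)/2`. -/
def zeta : ℂ := (1 + (Real.sqrt 3 : ℂ) * Complex.I) / 2

/-- The lattice `L_ζ = ℤζ + ℤ`. -/
def lattice : AddSubgroup ℂ := AddSubgroup.closure {zeta, 1}

/-- The complex torus `E_ζ = ℂ / L_ζ`, with its quotient topology. -/
abbrev Torus : Type := ℂ ⧸ lattice

/-- The affine smooth plane curve `y² = x³ + 1`. -/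
abbrev AffineModel : Type := {p : ℂ × ℂ // p.2 ^ 2 = p.1 ^ 3 + 1}

/-- The non-singular model of the plane curve `C_ζ : u⁶ = t³(t-1)`: the smooth projective curve
`y² = x³ + 1` (the affine curve together with its single point at infinity, with the topology of
the one-point compactification).  The normalization map to `C_ζ` is
`(x, y) ↦ (t, u) = (y²/x³, y/x²)`, or `[s₀ : s₁ : s₂] = [x³ : y² : xy]` in the projective plane,
with inverse `x = t/u²`, `y = u³/(t(t-1))`; see `u_pow_six` and `existsUnique_of_equation`.
The point at infinity lies over `(t, u) = (1, 0)`; the three points with `y = 0` lie over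
`(t, u) = (0, 0)`; the two points with `x = 0` lie over `t = ∞`. -/
abbrev Curve : Type := OnePoint AffineModel

/-- The point `P₁`, over `(t, u) = (1, 0)`. -/
def P₁ : Curve := OnePoint.infty

/-- The coordinate function `t` on the non-singular model.
(At its two poles, the points with `x = 0`, the value is immaterial.) -/
def t (P : Curve) : ℂ := OnePoint.elim P 1 (fun p => p.1.2 ^ 2 / p.1.1 ^ 3)

/-- The coordinate function `u` on the non-singular model.
(At its two poles, the points with `x = 0`, the value is immaterial.) -/
def u (P : Curve) : ℂ := OnePoint.elim P 0 (fun p => p.1.2 / p.1.1 ^ 2)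

/-- The two common poles of `t` and `u`: the points over `t = ∞`. -/
def poles : Set Curve := {P | ∃ p : AffineModel, P = (p : Curve) ∧ p.1.1 = 0}

/-- The six ramification points of the projection `t : C_ζ → ℙ¹`, i.e. the points over
`t = 0, 1, ∞`. -/
def ramification : Set Curve :=
  {P | P = P₁ ∨ ∃ p : AffineModel, P = (p : Curve) ∧ (p.1.1 = 0 ∨ p.1.2 = 0)}

theorem u_pow_six (P : Curve) (hP : P ∉ poles) : u P ^ 6 = t P ^ 3 * (t P - 1) := by
  induction P using OnePoint.rec with
  | infty => simp [u, t]
  | coe p =>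
    have hx : p.1.1 ≠ 0 := fun h => hP ⟨p, rfl, h⟩
    have h := p.2
    simp only [u, t, OnePoint.elim_some]
    field_simp
    rw [h]; ring

/-- Every point of the affine curve `u⁶ = t³(t-1)` other than its singular point `(0, 0)`
comes from exactly one point of the non-singular model. -/
theorem existsUnique_of_equation (a b : ℂ) (ha : a ≠ 0) (h : b ^ 6 = a ^ 3 * (a - 1)) :
    ∃! P : Curve, P ∉ poles ∧ t P = a ∧ u P = b := by
  have key : ∀ p : AffineModel, p.1.1 ≠ 0 → t (p : Curve) ≠ 1 := by
    intro p hx h1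
    have hp := p.2
    simp only [t, OnePoint.elim_some] at h1
    rw [div_eq_one_iff_eq (pow_ne_zero 3 hx), hp] at h1
    simp at h1
  by_cases h1 : a = 1
  · subst h1
    have hb : b = 0 := by simpa using h
    refine ⟨P₁, ⟨?_, by simp [t, P₁], by simp [u, P₁, hb]⟩, ?_⟩
    · rintro ⟨p, hp, -⟩
      exact OnePoint.infty_ne_coe p hp
    · rintro Q ⟨hQ, hQ1, -⟩
      induction Q using OnePoint.rec with
      | infty => rfl
      | coe p => exact absurd hQ1 (key p fun hx => hQ ⟨p, rfl, hx⟩)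
  · have ha1 : a - 1 ≠ 0 := sub_ne_zero.2 h1
    have hb : b ≠ 0 := by
      rintro rfl
      have : a ^ 3 * (a - 1) ≠ 0 := mul_ne_zero (pow_ne_zero 3 ha) ha1
      exact this (by rw [← h]; simp)
    have hE : (b ^ 3 / (a * (a - 1))) ^ 2 = (a / b ^ 2) ^ 3 + 1 := by
      field_simp
      linear_combination (b ^ 6 + a ^ 2 * (a - 1)) * h
    refine ⟨((⟨(a / b ^ 2, b ^ 3 / (a * (a - 1))), hE⟩ : AffineModel) : Curve),
      ⟨?_, ?_, ?_⟩, ?_⟩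
    · rintro ⟨p, hp, hx⟩
      rw [OnePoint.coe_eq_coe] at hp
      subst hp
      exact div_ne_zero ha (pow_ne_zero 2 hb) hx
    · simp only [t, OnePoint.elim_some]
      field_simp
      linear_combination (b ^ 6 + a ^ 3 * (a - 1)) * h
    · simp only [u, OnePoint.elim_some]
      field_simp
      linear_combination h
    · rintro Q ⟨hQ, hQt, hQu⟩
      induction Q using OnePoint.rec with
      | infty => exact absurd hQt.symm h1
      | coe p =>
        obtain ⟨⟨x, y⟩, hp⟩ := p
        have hx : x ≠ 0 := fun hx => hQ ⟨_, rfl, hx⟩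
        simp only [t, u, OnePoint.elim_some] at hQt hQu hp
        have hy : y ≠ 0 := by
          rintro rfl
          exact ha (by rw [← hQt]; simp)
        rw [OnePoint.coe_eq_coe]
        have ht1 : a - 1 = 1 / x ^ 3 := by
          rw [← hQt, hp]; field_simp; ring
        rw [Subtype.mk.injEq, Prod.mk.injEq, ht1, ← hQt, ← hQu]
        constructor <;> field_simp

/-- The coefficient of the pull-back of the form `ψ = u dt / (t(t-1))` under a map
`h : 𝕜 → C_ζ` (a curve when `𝕜 = ℝ`, a holomorphic map when `𝕜 = ℂ`), at a parameter value `s`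
where `h s` is not a ramification point: `h^*ψ = psiAlong h s • ds`. -/
def psiAlong {𝕜 : Type} [NontriviallyNormedField 𝕜] [NormedSpace 𝕜 ℂ] (h : 𝕜 → Curve) (s : 𝕜) :
    ℂ :=
  u (h s) * deriv (fun r => t (h r)) s / (t (h s) * (t (h s) - 1))

/-- A path of integration from `P₁` to `P` on the curve: it is continuous on `[0,1]`, and on
`(0,1)` it is continuously differentiable and avoids the ramification points; `ψ` is absolutely
integrable along it. -/
structure PathTo (P : Curve) where
  /-- the parametrization -/
  γ : ℝ → Curve
  continuousOn : ContinuousOn γ (Icc 0 1)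
  source : γ 0 = P₁
  target : γ 1 = P
  unramified : ∀ s ∈ Ioo (0 : ℝ) 1, γ s ∉ ramification
  contDiffOn : ContDiffOn ℝ 1 (fun s => t (γ s)) (Ioo 0 1)
  integrable : IntervalIntegrable (psiAlong γ) MeasureTheory.volume 0 1

/-- The integral `∫_γ ψ₁` of the normalized form `ψ₁ = ψ / ((1 - ζ²) B(1/3, 1/6))`. -/
def PathTo.integral {P : Curve} (c : PathTo P) : ℂ :=
  (∫ s in (0 : ℝ)..1, psiAlong c.γ s) / ((1 - zeta ^ 2) * Complex.betaIntegral (1 / 3) (1 / 6))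

open Classical in
/-- The Abel-Jacobi map `P ↦ ∫_{P₁}^P ψ₁ mod L_ζ`, the integral being taken along any path. -/
def abelJacobi (P : Curve) : Torus :=
  if h : Nonempty (PathTo P) then QuotientAddGroup.mk h.some.integral else 0

end ZetaCurve

end

noncomputable section

namespace ZetaCurve

open Complex ComplexConjugate

/-! ### The character `e` -/

/-! Everything rests on the symmetry of the hexagonal lattice `Λ = ℤζ + ℤ` under multiplication by
`ζ` and under complex conjugation. Write `E = ℘(1/2)`, `B = B(1/3, 1/6)` and `ω = (1 - ζ²) B`.

The curve. Since `ζΛ = Λ`, the invariant `g₂` vanishes and `℘'² = 4(℘³ - E³)`. Suitable multiples of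
`℘` and `℘'` therefore parametrize `y² = x³ + 1`, and give a homeomorphism from the torus to the
curve (`torusHomeomorph`). In these coordinates `ψ = -3 dx/y`, which pulls back to `ω dz`
(`psiAlong_uniformization`). If a path from `P₁` is lifted to `ℂ` starting at `0`, the integral of
`ψ₁` is the end point of the lift (`mk_integral`), so the Abel-Jacobi map is the inverse of the
uniformization. The scaling works because `ω⁶ = -(36 E)³`, that is, `B² = 12 E`; this comes from
writing the real half period `1/2` of `℘` as a beta integral (`betaIntegral_sixth_half`).

The theta constants. The point `ζ` is fixed by `τ ↦ 1 - 1/τ` and by `τ ↦ 1 - conj τ`. The first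
relates theta constants whose characteristics lie in one orbit (`theta_zeta_rotate`); the second
fixes each argument up to sign (`conj_theta_zeta`). For the size of `θ_{0,0}`, the eighth power of
the product of the even theta constants is `256 Δ` (`thetaProduct_eq_discriminant`); at `ζ` one has
`E₄ = 0`, so `Δ` is a multiple of `g₃² = 16 E⁶`, and `B² = 12 E` turns this into Gamma values.
Jacobi's duplication and quartic relations then carry the size over to the characteristics with
denominators 3 and 6. -/

theorem e_add (x y : ℂ) : e (x + y) = e x * e y := by
  simp only [e, mul_add, Complex.exp_add]

theorem e_zero : e 0 = 1 := by simp [e]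

theorem e_ne_zero (x : ℂ) : e x ≠ 0 := Complex.exp_ne_zero _

theorem e_neg (x : ℂ) : e (-x) = (e x)⁻¹ := by
  simp only [e, mul_neg, Complex.exp_neg]

theorem e_pow (x : ℂ) (n : ℕ) : e x ^ n = e (n * x) := by
  simp only [e, ← Complex.exp_nat_mul]; ring_nf

theorem e_int (n : ℤ) : e n = 1 := by
  rw [e, mul_comm]; exact Complex.exp_int_mul_two_pi_mul_I n

theorem e_eq_of_sub_int {x y : ℂ} (n : ℤ) (h : x = y + n) : e x = e y := by
  rw [h, e_add, e_int, mul_one]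

theorem conj_e (x : ℝ) : conj (e x) = e (-x) := by
  simp only [e, ← Complex.exp_conj, map_mul, conj_I, conj_ofReal, map_ofNat]; ring_nf

theorem norm_e (x : ℝ) : ‖e x‖ = 1 := by
  rw [e, show (2 * Real.pi * I * x : ℂ) = ((2 * Real.pi * x : ℝ) : ℂ) * I by push_cast; ring,
    Complex.norm_exp_ofReal_mul_I]

/-- A complex number with `conj w = e(-2φ) w` lies on the real line through `e(φ)`. -/
theorem exists_real_of_conj_eq {w : ℂ} (φ : ℝ) (h : conj w = e (-2 * φ) * w) :
    ∃ r : ℝ, w = e φ * r := by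
  have h1 : conj (e (-φ) * w) = e (-φ) * w := by
    have h3 : conj (e (-φ)) = e φ := by simpa using conj_e (-φ)
    rw [map_mul, h, h3, ← mul_assoc, ← e_add]
    congr 2; ring
  obtain ⟨r, hr⟩ := Complex.conj_eq_iff_real.1 h1
  refine ⟨r, ?_⟩
  rw [← hr, ← mul_assoc, ← e_add, add_neg_cancel, e_zero, one_mul]

/-! ### The number `ζ` -/

theorem zeta_sq : zeta ^ 2 = zeta - 1 := by
  have h : ((Real.sqrt 3 : ℝ) : ℂ) ^ 2 = 3 := by
    rw [← ofReal_pow, Real.sq_sqrt (by norm_num)]; norm_num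
  simp only [zeta]
  linear_combination (1 / 4) * I ^ 2 * h + (3 / 4) * I_sq

theorem zeta_im : zeta.im = Real.sqrt 3 / 2 := by simp [zeta]

theorem zeta_im_pos : 0 < zeta.im := by rw [zeta_im]; positivity

theorem zeta_ne_zero : zeta ≠ 0 := fun h => by simpa [h] using zeta_im_pos

theorem zeta_eq_e : zeta = e (1 / 6) := by
  rw [e, show (2 * Real.pi * I * (1 / 6) : ℂ) = ((Real.pi / 3 : ℝ) : ℂ) * I by push_cast; ring,
    Complex.exp_mul_I, ← ofReal_cos, ← ofReal_sin, Real.cos_pi_div_three, Real.sin_pi_div_three,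
    zeta]
  push_cast; ring

theorem conj_zeta : conj zeta = 1 - zeta := by
  simp only [zeta, map_div₀, map_add, map_mul, map_one, conj_I, conj_ofReal, map_ofNat]; ring

theorem neg_one_div_zeta : -1 / zeta = zeta - 1 := by
  rw [div_eq_iff zeta_ne_zero]; linear_combination -zeta_sq

/-! ### Transformation formulas of theta functions -/

theorem theta_eq_jacobiTheta₂ (a b : ℝ) (z τ : ℂ) :
    theta a b z τ = cexp (Real.pi * I * a ^ 2 * τ + 2 * Real.pi * I * a * (z + b)) *
      jacobiTheta₂ (z + b + a * τ) τ := by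
  rw [theta, jacobiTheta₂, ← tsum_mul_left]
  refine tsum_congr fun n => ?_
  rw [jacobiTheta₂_term, ← Complex.exp_add]
  ring_nf

theorem summable_theta_term (a b : ℝ) (z : ℂ) {τ : ℂ} (hτ : 0 < τ.im) :
    Summable fun n : ℤ => cexp (Real.pi * I * ((n : ℂ) + a) ^ 2 * τ
      + 2 * Real.pi * I * ((n : ℂ) + a) * (z + b)) := by
  refine ((((summable_jacobiTheta₂_term_iff (z + b + a * τ) τ).2 hτ).mul_left
    (cexp (Real.pi * I * a ^ 2 * τ + 2 * Real.pi * I * a * (z + b)))).congr fun n => ?_)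
  rw [jacobiTheta₂_term, ← Complex.exp_add]
  ring_nf

theorem theta_add_one_left (a b : ℝ) (z τ : ℂ) : theta (a + 1) b z τ = theta a b z τ := by
  rw [theta, theta]
  conv_rhs => rw [← (Equiv.addRight (1 : ℤ)).tsum_eq]
  refine tsum_congr fun n => ?_
  simp only [Equiv.coe_addRight]
  push_cast; ring_nf

theorem theta_add_one_right (a b : ℝ) (z τ : ℂ) :
    theta a (b + 1) z τ = e a * theta a b z τ := by
  rw [theta, theta, ← tsum_mul_left]
  refine tsum_congr fun n => ?_
  rw [e, ← Complex.exp_add, Complex.exp_eq_exp_iff_exists_int]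
  exact ⟨n, by push_cast; ring⟩

theorem theta_neg_neg (a b : ℝ) (z τ : ℂ) : theta (-a) (-b) (-z) τ = theta a b z τ := by
  rw [theta, theta, ← (Equiv.neg ℤ).tsum_eq]
  refine tsum_congr fun n => ?_
  simp only [Equiv.neg_apply]
  push_cast; ring_nf

theorem theta_add_one_modulus (a b : ℝ) (z τ : ℂ) :
    theta a b z (τ + 1) = e (-(a ^ 2 + a) / 2) * theta a (a + b + 1 / 2) z τ := by
  rw [theta, theta, ← tsum_mul_left]
  refine tsum_congr fun n => ?_
  rw [e, ← Complex.exp_add, Complex.exp_eq_exp_iff_exists_int]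
  -- The two exponents differ by `πi n(n-1)`, a multiple of `2πi`.
  obtain ⟨k, hk⟩ := Int.even_mul_pred_self n
  refine ⟨k, ?_⟩
  have hk' : (n : ℂ) * (n - 1) = k + k := by exact_mod_cast hk
  push_cast
  linear_combination (Real.pi * I) * hk'

theorem conj_theta (a b : ℝ) (τ : ℂ) :
    conj (theta a b 0 τ) = theta a (-b) 0 (-conj τ) := by
  rw [theta, theta, Complex.conj_tsum]
  refine tsum_congr fun n => ?_
  rw [← Complex.exp_conj]
  simp only [map_add, map_mul, map_pow, conj_I, conj_ofReal, map_ofNat, map_intCast, map_zero]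
  push_cast; ring_nf

/-- The functional equation of `jacobiTheta₂`, combined with its evenness in the first variable to
bring the characteristic to the form `(b, -a)`. -/
theorem theta_neg_one_div (a b : ℝ) {τ : ℂ} (hτ : 0 < τ.im) :
    theta a b 0 τ = ((-I * τ) ^ (1 / 2 : ℂ))⁻¹ * e (a * b) * theta b (-a) 0 (-1 / τ) := by
  have h0 : τ ≠ 0 := fun h => by simp [h] at hτ
  rw [theta_eq_jacobiTheta₂, theta_eq_jacobiTheta₂, jacobiTheta₂_functional_equation,
    ← jacobiTheta₂_neg_left]
  have h1 : -((0 + b + a * τ : ℂ) / τ) = 0 + ((-a : ℝ) : ℂ) + b * (-1 / τ) := by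
    push_cast; field_simp; ring
  rw [h1, one_div ((-I * τ) ^ (1 / 2 : ℂ)), e]
  simp only [← mul_assoc]
  congr 1
  rw [mul_comm _ (((-I * τ) ^ (1 / 2 : ℂ))⁻¹)]
  simp only [mul_assoc, ← Complex.exp_add]
  congr 2
  push_cast
  field_simp
  ring

/-! ### Product relations through the modulus `2τ` -/

/-- The equivalence `(ε, p, q) ↦ (p + q + ε, p - q)` between `{0, 1} × ℤ × ℤ` and `ℤ × ℤ`. -/
def sumDiffEquiv : (ℤ × ℤ) ⊕ (ℤ × ℤ) ≃ ℤ × ℤ where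
  toFun := Sum.elim (fun p => (p.1 + p.2, p.1 - p.2)) (fun p => (p.1 + p.2 + 1, p.1 - p.2))
  invFun p := if (p.1 + p.2) % 2 = 0 then Sum.inl ((p.1 + p.2) / 2, (p.1 - p.2) / 2)
    else Sum.inr ((p.1 + p.2 - 1) / 2, (p.1 - p.2 - 1) / 2)
  left_inv := by
    rintro (⟨p, q⟩ | ⟨p, q⟩)
    · dsimp only [Sum.elim_inl]
      split_ifs with h
      · rw [Sum.inl.injEq, Prod.mk.injEq]; omega
      · omega
    · dsimp only [Sum.elim_inr]
      split_ifs with h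
      · omega
      · rw [Sum.inr.injEq, Prod.mk.injEq]; omega
  right_inv := by
    rintro ⟨n, m⟩
    by_cases h : (n + m) % 2 = 0
    · simp only [h, if_true, Sum.elim_inl, Prod.mk.injEq]; omega
    · simp only [h, if_false, Sum.elim_inr, Prod.mk.injEq]; omega

/-- The product of two theta constants, in terms of theta constants of modulus `2τ`. -/
theorem theta_mul_theta (a b c d : ℝ) {τ : ℂ} (hτ : 0 < τ.im) :
    theta a b 0 τ * theta c d 0 τ =
      theta ((a + c) / 2) (b + d) 0 (2 * τ) * theta ((a - c) / 2) (b - d) 0 (2 * τ) +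
      theta ((a + c) / 2 + 1 / 2) (b + d) 0 (2 * τ) *
        theta ((a - c) / 2 + 1 / 2) (b - d) 0 (2 * τ) := by
  have h2 : 0 < (2 * τ).im := by simpa using hτ
  have hs : ∀ (a b : ℝ) {τ : ℂ}, 0 < τ.im → Summable fun n : ℤ =>
      ‖cexp (Real.pi * I * ((n : ℂ) + a) ^ 2 * τ
        + 2 * Real.pi * I * ((n : ℂ) + a) * (0 + b))‖ :=
    fun a b τ h => (summable_theta_term a b 0 h).norm
  simp only [theta]
  rw [tsum_mul_tsum_of_summable_norm (hs a b hτ) (hs c d hτ),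
    tsum_mul_tsum_of_summable_norm (hs _ _ h2) (hs _ _ h2),
    tsum_mul_tsum_of_summable_norm (hs _ _ h2) (hs _ _ h2), ← sumDiffEquiv.tsum_eq]
  have hsum := summable_mul_of_summable_norm (hs a b hτ) (hs c d hτ)
  have hsum' := (sumDiffEquiv.summable_iff).2 hsum
  refine (Summable.tsum_sum (hsum'.comp_injective Sum.inl_injective)
    (hsum'.comp_injective Sum.inr_injective)).trans ?_
  -- Termwise this is the parallelogram identity `X² + Y² = 2((X+Y)/2)² + 2((X-Y)/2)²`; the two sums
  -- correspond to the parity of `n + m`.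
  congr 1 <;>
  · refine tsum_congr fun p => ?_
    simp only [sumDiffEquiv, Function.comp_apply, Equiv.coe_fn_mk, Sum.elim_inl, Sum.elim_inr,
      ← Complex.exp_add]
    congr 1
    push_cast
    ring

/-- The characteristic is odd: reflecting the sum and shifting both characteristics back by integers
gives minus the same series. -/
theorem theta_half_half_zero (τ : ℂ) : theta (1 / 2) (-1 / 2) 0 τ = 0 := by
  have h1 := theta_neg_neg (1 / 2) (-1 / 2) 0 τ
  have h2 := theta_add_one_left (-(1 / 2)) (-(-1 / 2)) (-0) τ
  have h3 := theta_add_one_right (1 / 2) (-1 / 2) 0 τ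
  have h4 : e ((1 / 2 : ℝ) : ℂ) = -1 := by
    rw [e, show (2 * Real.pi * I * ((1 / 2 : ℝ) : ℂ) : ℂ) = Real.pi * I by push_cast; ring,
      Complex.exp_pi_mul_I]
  rw [h4] at h3
  norm_num at h1 h2 h3
  rw [h1] at h2
  rw [neg_div]
  exact self_eq_neg.1 (h2.symm.trans h3)

/-- The square of a theta constant, in terms of theta constants of modulus `2τ`. -/
theorem theta_sq (a b : ℝ) {τ : ℂ} (hτ : 0 < τ.im) :
    theta a b 0 τ ^ 2 = theta a (2 * b) 0 (2 * τ) * theta 0 0 0 (2 * τ) +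
      theta (a + 1 / 2) (2 * b) 0 (2 * τ) * theta (1 / 2) 0 0 (2 * τ) := by
  rw [sq, theta_mul_theta _ _ _ _ hτ, add_self_div_two, sub_self, zero_div, zero_add, sub_self,
    two_mul b]

theorem theta_mul_theta_add_half (a b : ℝ) {τ : ℂ} (hτ : 0 < τ.im) :
    theta a b 0 τ * theta a (b + 1 / 2) 0 τ =
      theta a (2 * b + 1 / 2) 0 (2 * τ) * theta 0 (-1 / 2) 0 (2 * τ) := by
  rw [theta_mul_theta _ _ _ _ hτ, add_self_div_two, sub_self, zero_div, zero_add,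
    show b - (b + 1 / 2) = -1 / 2 by ring, theta_half_half_zero, mul_zero, add_zero,
    show b + (b + 1 / 2) = 2 * b + 1 / 2 by ring]

/-- Jacobi's duplication formula, for theta constants with characteristics. -/
theorem theta_duplication (a b : ℝ) {τ : ℂ} (hτ : 0 < τ.im) :
    2 * (theta a b 0 τ * theta a (b + 1 / 2) 0 τ *
      (theta (a + 1 / 2) b 0 τ * theta (a + 1 / 2) (b + 1 / 2) 0 τ)) =
    theta (2 * a + 1 / 2) (2 * b + 1 / 2) 0 τ * theta (1 / 2) 0 0 τ *
      (theta 0 0 0 τ * theta 0 (1 / 2) 0 τ) := by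
  have h00 : theta 0 0 0 τ * theta 0 (1 / 2) 0 τ = theta 0 (-1 / 2) 0 (2 * τ) ^ 2 := by
    have h := theta_mul_theta_add_half 0 0 hτ
    have := theta_add_one_right 0 (-1 / 2) 0 (2 * τ)
    rw [ofReal_zero, e_zero, one_mul, show (-1 / 2 + 1 : ℝ) = 1 / 2 by norm_num] at this
    rw [mul_zero, zero_add, this] at h
    rw [h, sq]
  have h3 : theta (2 * a + 1 / 2) (2 * b + 1 / 2) 0 τ * theta (1 / 2) 0 0 τ =
      2 * (theta a (2 * b + 1 / 2) 0 (2 * τ) * theta (a + 1 / 2) (2 * b + 1 / 2) 0 (2 * τ)) := by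
    rw [theta_mul_theta _ _ _ _ hτ]
    have := theta_add_one_left a (2 * b + 1 / 2) 0 (2 * τ)
    rw [show (2 * a + 1 / 2 + 1 / 2) / 2 + 1 / 2 = a + 1 by ring,
      show (2 * a + 1 / 2 + 1 / 2) / 2 = a + 1 / 2 by ring,
      show (2 * a + 1 / 2 - 1 / 2) / 2 = a by ring, add_zero, sub_zero, this]
    ring
  rw [h00, theta_mul_theta_add_half _ _ hτ, theta_mul_theta_add_half _ _ hτ, h3]; ring

theorem e_half : e (1 / 2) = -1 := by
  rw [e, show (2 * Real.pi * I * (1 / 2) : ℂ) = Real.pi * I by ring, Complex.exp_pi_mul_I]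

/-- Jacobi's quartic relation, for theta constants with characteristics. -/
theorem theta_quartic (a b : ℝ) {τ : ℂ} (hτ : 0 < τ.im) :
    theta a b 0 τ ^ 4 - e (-2 * a) * theta a (b + 1 / 2) 0 τ ^ 4 =
      theta (a + 1 / 2) b 0 τ ^ 4 - e (-2 * a) * theta (a + 1 / 2) (b + 1 / 2) 0 τ ^ 4 := by
  -- All four squares are bilinear in `A, B` and `A₀, B₀`, and both sides of the relation reduce to
  -- `4 A A₀ B B₀`.
  set A := theta a (2 * b) 0 (2 * τ) with hA
  set B := theta (a + 1 / 2) (2 * b) 0 (2 * τ) with hB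
  set A₀ := theta 0 0 0 (2 * τ)
  set B₀ := theta (1 / 2) 0 0 (2 * τ)
  have he : e ((a + 1 / 2 : ℝ) : ℂ) = - e a := by
    push_cast
    rw [e_add, e_half]
    ring
  have he2 : e (-2 * a) * e a ^ 2 = 1 := by
    rw [e_pow, ← e_add]; norm_num [e_zero]
  have h1 : theta a b 0 τ ^ 2 = A * A₀ + B * B₀ := theta_sq a b hτ
  have h2 : theta a (b + 1 / 2) 0 τ ^ 2 = e a * (A * A₀ - B * B₀) := by
    rw [theta_sq _ _ hτ, show 2 * (b + 1 / 2) = 2 * b + 1 by ring, theta_add_one_right,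
      theta_add_one_right, he]; ring
  have h3 : theta (a + 1 / 2) b 0 τ ^ 2 = B * A₀ + A * B₀ := by
    rw [theta_sq _ _ hτ, show a + 1 / 2 + 1 / 2 = a + 1 by ring, theta_add_one_left]
  have h4 : theta (a + 1 / 2) (b + 1 / 2) 0 τ ^ 2 = e a * (A * B₀ - B * A₀) := by
    rw [theta_sq _ _ hτ, show a + 1 / 2 + 1 / 2 = a + 1 by ring, theta_add_one_left,
      show 2 * (b + 1 / 2) = 2 * b + 1 by ring, theta_add_one_right,
      theta_add_one_right, he]; ring
  have hp : ∀ x : ℂ, x ^ 4 = (x ^ 2) ^ 2 := fun x => by ring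
  rw [hp, hp (theta a (b + 1 / 2) 0 τ), hp (theta (a + 1 / 2) b 0 τ),
    hp (theta (a + 1 / 2) (b + 1 / 2) 0 τ), h1, h2, h3, h4]
  linear_combination (-(A * A₀ - B * B₀) ^ 2 + (A * B₀ - B * A₀) ^ 2) * he2

end ZetaCurve

namespace ZetaCurve

open Complex ComplexConjugate

/-! ### Theta constants at `ζ` -/

theorem neg_I_mul_zeta_cpow : (-I * zeta) ^ (1 / 2 : ℂ) = e (-1 / 24) := by
  have h : -I * zeta = cexp (-(Real.pi / 6 : ℝ) * I) := by
    rw [zeta_eq_e, e, ← Complex.exp_neg_pi_div_two_mul_I, ← Complex.exp_add]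
    congr 1; push_cast; ring
  have hpi := Real.pi_pos
  rw [h, Complex.cpow_def_of_ne_zero (Complex.exp_ne_zero _), Complex.log_exp, e]
  · congr 1; push_cast; ring
  · simp; linarith
  · simp; linarith

/-- Inversion sends `ζ` to `ζ - 1` and translation brings it back, so `ζ` is an elliptic fixed point
and the characteristics are permuted by `(a, b) ↦ (b, -a - b - 1/2)`. The `1/24` comes from the
principal root of `-iζ = exp(-πi/6)`. -/
theorem theta_zeta_rotate (a b : ℝ) : theta a b 0 zeta =
    e (1 / 24 + a * b + (b ^ 2 + b) / 2) * theta b (-a - b - 1 / 2) 0 zeta := by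
  have h := theta_add_one_modulus b (-a - b - 1 / 2) 0 (zeta - 1)
  rw [sub_add_cancel, show b + (-a - b - 1 / 2) + 1 / 2 = -a by ring] at h
  rw [theta_neg_one_div a b zeta_im_pos, neg_I_mul_zeta_cpow, neg_one_div_zeta, h, ← e_neg,
    ← mul_assoc, ← e_add, ← e_add]
  congr 2
  ring

/-- Conjugation replaces `τ` by `-conj τ`, and `-conj ζ = ζ - 1` is one translation away from `ζ`.
When the new characteristic agrees with the old one modulo integers, or lies in its rotation orbit,
this determines the argument up to sign. -/
theorem conj_theta_zeta (a b : ℝ) : conj (theta a b 0 zeta) =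
    e ((a ^ 2 + a) / 2) * theta a (-a - b - 1 / 2) 0 zeta := by
  have h := theta_add_one_modulus a (-a - b - 1 / 2) 0 (zeta - 1)
  rw [sub_add_cancel, show a + (-a - b - 1 / 2) + 1 / 2 = -b by ring] at h
  rw [conj_theta, conj_zeta, neg_sub, h, ← mul_assoc, ← e_add]
  ring_nf
  rw [e_zero, one_mul]

/-! ### Positivity: the leading term dominates -/

theorem norm_jacobiTheta₂_sub_one_le {z τ : ℂ} (h : 2 * |z.im| < τ.im) :
    ‖jacobiTheta₂ z τ - 1‖ ≤ 2 * (Real.exp (-Real.pi * (τ.im - 2 * |z.im|)) /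
      (1 - Real.exp (-Real.pi * (τ.im - 2 * |z.im|)))) := by
  set x := Real.exp (-Real.pi * (τ.im - 2 * |z.im|)) with hx
  have hτ : 0 < τ.im := lt_of_le_of_lt (by positivity) h
  have hx0 : 0 < x := Real.exp_pos _
  have hx1 : x < 1 := by
    rw [hx, Real.exp_lt_one_iff]; nlinarith [Real.pi_pos]
  have h1 := (hasSum_jacobiTheta₂_term z hτ).nat_add_neg
  rw [← hasSum_nat_add_iff' 1] at h1
  have h0 : jacobiTheta₂_term 0 z τ = 1 := by simp [jacobiTheta₂_term]
  simp only [Finset.sum_range_one, Nat.cast_zero, neg_zero, h0] at h1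
  -- From `|n| ≤ n²`, the terms are dominated by a geometric series in `x` on each side of `n = 0`.
  have hb : ∀ n : ℤ, 1 ≤ |n| → ‖jacobiTheta₂_term n z τ‖ ≤ x ^ n.natAbs := by
    intro n hn
    rw [norm_jacobiTheta₂_term, hx, ← Real.exp_nat_mul]
    apply Real.exp_le_exp.2
    have hn' : (1 : ℝ) ≤ |(n : ℝ)| := by exact_mod_cast hn
    have h2 : ((n.natAbs : ℕ) : ℝ) = |(n : ℝ)| := by
      rw [Nat.cast_natAbs, Int.cast_abs]
    rw [h2]
    have h3 : -(n * z.im) ≤ |(n : ℝ)| * |z.im| := by rw [← abs_mul]; exact neg_le_abs _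
    have h4 : |(n : ℝ)| * τ.im ≤ n ^ 2 * τ.im := by
      rw [← sq_abs (n : ℝ), sq]; gcongr; exact le_mul_of_one_le_left (abs_nonneg _) hn'
    nlinarith [Real.pi_pos]
  have hg : HasSum (fun n : ℕ => 2 * x ^ (n + 1)) (2 * (x / (1 - x))) := by
    have := (hasSum_geometric_of_lt_one hx0.le hx1).mul_left (2 * x)
    simpa only [pow_succ', ← mul_assoc, div_eq_mul_inv] using this
  have := h1.norm_le_of_bounded hg fun n => by
    refine (norm_add_le _ _).trans ?_
    have e1 := hb ((n + 1 : ℕ) : ℤ) (by push_cast; rw [abs_of_nonneg (by positivity)]; linarith)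
    have e2 := hb (-((n + 1 : ℕ) : ℤ))
      (by push_cast; rw [abs_neg, abs_of_nonneg (by positivity)]; linarith)
    rw [Int.natAbs_natCast] at e1
    rw [Int.natAbs_neg, Int.natAbs_natCast] at e2
    linarith
  rwa [show jacobiTheta₂ z τ + 1 - (1 + 1) = jacobiTheta₂ z τ - 1 by ring] at this

theorem jacobiTheta₂_zeta_re_pos {z : ℂ} (h : |z.im| ≤ zeta.im / 6) :
    0 < (jacobiTheta₂ z zeta).re := by
  have hz := zeta_im_pos
  have h1 := norm_jacobiTheta₂_sub_one_le (z := z) (τ := zeta) (by linarith)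
  set x := Real.exp (-Real.pi * (zeta.im - 2 * |z.im|)) with hx
  have hx0 : 0 < x := Real.exp_pos _
  -- The bound `2x/(1-x)` is below `1` exactly when `x < 1/3`.
  have hx1 : x < 1 / 3 := by
    have h3 : (1.7 : ℝ) ≤ Real.sqrt 3 := Real.le_sqrt_of_sq_le (by norm_num)
    have h2 : (1.7 : ℝ) ≤ Real.pi * (zeta.im - 2 * |z.im|) := by
      have : Real.sqrt 3 / 3 ≤ zeta.im - 2 * |z.im| := by rw [zeta_im] at *; linarith
      nlinarith [Real.pi_gt_three]
    have h4 : (3 : ℝ) < Real.exp (1.7) := by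
      have := Real.add_one_le_exp (0.85 : ℝ)
      rw [show (1.7 : ℝ) = 0.85 + 0.85 by norm_num, Real.exp_add]
      nlinarith
    have h5 : x ≤ Real.exp (-1.7) := Real.exp_le_exp.2 (by linarith)
    rw [Real.exp_neg] at h5
    refine h5.trans_lt ?_
    rw [one_div]
    exact inv_strictAnti₀ (by norm_num) h4
  have h2 : 2 * (x / (1 - x)) < 1 := by
    rw [← mul_div_assoc, div_lt_one (by linarith)]; linarith
  have h3 := (Complex.abs_re_le_norm (jacobiTheta₂ z zeta - 1)).trans_lt (h1.trans_lt h2)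
  rw [abs_lt] at h3
  simp only [sub_re, one_re] at h3
  linarith

/-! ### Arguments of the theta constants and relations between their sizes -/

theorem theta_zeta_zero_half : theta 0 (1 / 2) 0 zeta = e (-1 / 24) * theta 0 0 0 zeta := by
  have h := theta_zeta_rotate 0 0
  have h1 := theta_add_one_right 0 (-1 / 2) 0 zeta
  norm_num [e_zero] at h h1
  rw [h1, h, ← mul_assoc, ← e_add]
  norm_num [e_zero]

theorem theta_zeta_half_zero : theta (1 / 2) 0 0 zeta = e (1 / 24) * theta 0 0 0 zeta := by
  have h := theta_zeta_rotate 0 (1 / 2)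
  have h1 := theta_add_one_right (1 / 2) (-1) 0 zeta
  rw [show (-0 - 1 / 2 - 1 / 2 : ℝ) = -1 by norm_num] at h
  rw [neg_add_cancel] at h1
  rw [theta_zeta_zero_half] at h
  have h2 : theta 0 0 0 zeta = e (-(-1 / 24)) * (e (-1 / 24) * theta 0 0 0 zeta) := by
    rw [← mul_assoc, ← e_add, neg_add_cancel, e_zero, one_mul]
  rw [h1, h2, h]
  simp only [← mul_assoc, ← e_add]
  congr 1
  refine e_eq_of_sub_int 0 ?_
  push_cast; ring

theorem theta_zeta_zero_zero :
    theta 0 0 0 zeta = e (1 / 48) * (‖theta 0 0 0 zeta‖ : ℝ) := by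
  obtain ⟨r, hr⟩ := exists_real_of_conj_eq (w := theta 0 0 0 zeta) (1 / 48) (by
    have h1 := theta_add_one_right 0 (-1 / 2) 0 zeta
    rw [conj_theta_zeta]
    norm_num [e_zero] at h1 ⊢
    rw [← h1, theta_zeta_zero_half]
    congr 2; norm_num)
  -- The argument is known up to sign only; positivity of the real part, against `cos(π/24) > 0`,
  -- decides the sign.
  have hre : 0 < (theta 0 0 0 zeta).re := by
    rw [theta_eq_jacobiTheta₂]
    norm_num
    exact jacobiTheta₂_zeta_re_pos (by simpa using by linarith [zeta_im_pos])
  have h2 : (e ((1 / 48 : ℝ) : ℂ)).re = Real.cos (Real.pi / 24) := by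
    rw [e, show (2 * Real.pi * I * ((1 / 48 : ℝ) : ℂ)) = ((Real.pi / 24 : ℝ) : ℂ) * I by
      push_cast; ring, Complex.exp_ofReal_mul_I_re]
  have h3 : 0 < Real.cos (Real.pi / 24) :=
    Real.cos_pos_of_mem_Ioo ⟨by linarith [Real.pi_pos], by linarith [Real.pi_pos]⟩
  have h4 : 0 < r := by
    rw [hr, re_mul_ofReal, h2] at hre
    exact pos_of_mul_pos_right hre h3.le
  have h5 : ‖theta 0 0 0 zeta‖ = r := by
    rw [hr, norm_mul, norm_e, one_mul, Complex.norm_real, Real.norm_of_nonneg h4.le]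
  rw [h5, hr]; push_cast; rfl

theorem exists_theta_zeta_sixth :
    ∃ r : ℝ, 0 < r ∧ theta (1 / 6) (1 / 6) 0 zeta = e (5 / 144) * r := by
  obtain ⟨r, hr⟩ := exists_real_of_conj_eq (w := theta (1 / 6) (1 / 6) 0 zeta) (5 / 144) (by
    have h1 := theta_add_one_right (1 / 6) (-5 / 6) 0 zeta
    rw [show (-5 / 6 + 1 : ℝ) = 1 / 6 by norm_num] at h1
    rw [conj_theta_zeta, show (-(1 / 6) - 1 / 6 - 1 / 2 : ℝ) = -5 / 6 by norm_num, h1,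
      ← mul_assoc, ← e_add]
    congr 2; push_cast; norm_num)
  refine ⟨r, ?_, by rw [hr]; push_cast; rfl⟩
  have h1 := theta_eq_jacobiTheta₂ (1 / 6) (1 / 6) 0 zeta
  -- The exponential factor already carries the full phase `e(5/144)`, so `r` is a positive number
  -- times a value of `jacobiTheta₂`, at a point with `Im z = Im ζ / 6`: the extreme case of the
  -- positivity lemma.
  have h2 : cexp (Real.pi * I * ((1 / 6 : ℝ) : ℂ) ^ 2 * zeta +
      2 * Real.pi * I * ((1 / 6 : ℝ) : ℂ) * (0 + ((1 / 6 : ℝ) : ℂ))) =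
      e ((5 / 144 : ℝ) : ℂ) * (Real.exp (-Real.pi * Real.sqrt 3 / 72) : ℝ) := by
    rw [e, ofReal_exp, ← Complex.exp_add, zeta]
    congr 1
    push_cast
    linear_combination (Real.pi * (Real.sqrt 3 : ℝ) / 72 : ℂ) * I_sq
  rw [h2, hr, mul_assoc] at h1
  have h3 := mul_left_cancel₀ (e_ne_zero _) h1
  have h4 := congrArg re h3
  rw [ofReal_re, re_ofReal_mul] at h4
  rw [h4]
  refine mul_pos (Real.exp_pos _) (jacobiTheta₂_zeta_re_pos (le_of_eq ?_))
  simp [abs_of_pos zeta_im_pos]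
  ring

/-- Modulo integers, `(1/3, 1/3)`, `(1/3, 5/6)`, `(5/6, 1/3)` form one orbit of the rotation. -/
theorem theta_zeta_third_five_sixths :
    theta (1 / 3) (5 / 6) 0 zeta = e (42 / 144) * theta (1 / 3) (1 / 3) 0 zeta := by
  have h := theta_zeta_rotate (1 / 3) (1 / 3)
  have h1 := theta_add_one_right (1 / 3) (-7 / 6) 0 zeta
  have h2 := theta_add_one_right (1 / 3) (-1 / 6) 0 zeta
  rw [show (-(1 / 3) - 1 / 3 - 1 / 2 : ℝ) = -7 / 6 by norm_num] at h
  rw [show (-7 / 6 + 1 : ℝ) = -1 / 6 by norm_num] at h1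
  rw [show (-1 / 6 + 1 : ℝ) = 5 / 6 by norm_num] at h2
  rw [h2, h1, h]
  simp only [← mul_assoc, ← e_add]
  congr 1
  refine e_eq_of_sub_int 0 ?_
  push_cast; norm_num

theorem theta_zeta_five_sixths_third :
    theta (5 / 6) (1 / 3) 0 zeta = e (-18 / 144) * theta (1 / 3) (1 / 3) 0 zeta := by
  have h := theta_zeta_rotate (1 / 3) (5 / 6)
  have h1 := theta_add_one_right (5 / 6) (-5 / 3) 0 zeta
  have h2 := theta_add_one_right (5 / 6) (-2 / 3) 0 zeta
  rw [show (-(1 / 3) - 5 / 6 - 1 / 2 : ℝ) = -5 / 3 by norm_num, theta_zeta_third_five_sixths] at h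
  rw [show (-5 / 3 + 1 : ℝ) = -2 / 3 by norm_num] at h1
  rw [show (-2 / 3 + 1 : ℝ) = 1 / 3 by norm_num] at h2
  have h3 : theta (1 / 3) (1 / 3) 0 zeta =
      e (-(42 / 144)) * (e (42 / 144) * theta (1 / 3) (1 / 3) 0 zeta) := by
    rw [← mul_assoc, ← e_add, neg_add_cancel, e_zero, one_mul]
  rw [h2, h1, h3, h]
  simp only [← mul_assoc, ← e_add]
  congr 1
  refine e_eq_of_sub_int 1 ?_
  push_cast; norm_num

theorem theta_five_sixths_five_sixths (τ : ℂ) :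
    theta (5 / 6) (5 / 6) 0 τ = e (-1 / 6) * theta (1 / 6) (1 / 6) 0 τ := by
  have h1 := theta_add_one_left (-(1 / 6)) (5 / 6) 0 τ
  have h2 := theta_add_one_right (-(1 / 6)) (-(1 / 6)) 0 τ
  have h3 := theta_neg_neg (1 / 6) (1 / 6) 0 τ
  rw [neg_zero] at h3
  rw [show (-(1 / 6) + 1 : ℝ) = 5 / 6 by norm_num] at h1 h2
  rw [h1, h2, h3]
  congr 2; push_cast; ring

theorem theta_seven_sixths_seven_sixths (τ : ℂ) :
    theta (7 / 6) (7 / 6) 0 τ = e (1 / 6) * theta (1 / 6) (1 / 6) 0 τ := by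
  have h1 := theta_add_one_left (1 / 6) (7 / 6) 0 τ
  have h2 := theta_add_one_right (1 / 6) (1 / 6) 0 τ
  rw [show (1 / 6 + 1 : ℝ) = 7 / 6 by norm_num] at h1 h2
  rw [h1, h2]
  congr 2; push_cast; ring

theorem exists_theta_zeta_third :
    ∃ r : ℝ, 2 * r ^ 3 = ‖theta 0 0 0 zeta‖ ^ 3 ∧
      theta (1 / 3) (1 / 3) 0 zeta = e (11 / 144) * r := by
  obtain ⟨r, hr⟩ := exists_real_of_conj_eq (w := theta (1 / 3) (1 / 3) 0 zeta) (11 / 144) (by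
    have h1 := theta_add_one_right (1 / 3) (-7 / 6) 0 zeta
    have h2 := theta_add_one_right (1 / 3) (-1 / 6) 0 zeta
    rw [show (-7 / 6 + 1 : ℝ) = -1 / 6 by norm_num] at h1
    rw [show (-1 / 6 + 1 : ℝ) = 5 / 6 by norm_num, h1, theta_zeta_third_five_sixths] at h2
    have h3 : theta (1 / 3) (-7 / 6) 0 zeta = e (-(2 / 3)) *
        (e ((1 / 3 : ℝ) : ℂ) * (e ((1 / 3 : ℝ) : ℂ) * theta (1 / 3) (-7 / 6) 0 zeta)) := by
      simp only [← mul_assoc, ← e_add]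
      push_cast
      norm_num [e_zero]
    rw [conj_theta_zeta, show (-(1 / 3) - 1 / 3 - 1 / 2 : ℝ) = -7 / 6 by norm_num, h3, ← h2]
    simp only [← mul_assoc, ← e_add]
    congr 1
    refine e_eq_of_sub_int 0 ?_
    push_cast; norm_num)
  obtain ⟨s, hs, hs'⟩ := exists_theta_zeta_sixth
  refine ⟨r, ?_, by rw [hr]; push_cast; rfl⟩
  set N := ‖theta 0 0 0 zeta‖
  -- The left side contains the whole orbit of `(1/3, 1/3)`, the right side the three even theta
  -- constants. The remaining factors `θ_{5/6,5/6}` and `θ_{7/6,7/6}` are both phases times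
  -- `θ_{1/6,1/6}`, whose modulus `s > 0` cancels.
  have h := theta_duplication (1 / 3) (1 / 3) zeta_im_pos
  rw [show (1 / 3 + 1 / 2 : ℝ) = 5 / 6 by norm_num,
    show (2 * (1 / 3) + 1 / 2 : ℝ) = 7 / 6 by norm_num, theta_five_sixths_five_sixths,
    theta_seven_sixths_seven_sixths, theta_zeta_five_sixths_third, theta_zeta_third_five_sixths,
    theta_zeta_half_zero, theta_zeta_zero_half, theta_zeta_zero_zero, hs', hr] at h
  have h1 : e (38 / 144) * (2 * r ^ 3 * s : ℝ) = e (38 / 144) * (N ^ 3 * s : ℝ) := by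
    have e1 : e (38 / 144) = e ((11 / 144 : ℝ) : ℂ) * (e (42 / 144) * e ((11 / 144 : ℝ) : ℂ)) *
        (e (-18 / 144) * e ((11 / 144 : ℝ) : ℂ) * (e (-1 / 6) * e (5 / 144))) := by
      simp only [← e_add]
      refine e_eq_of_sub_int 0 ?_
      push_cast; norm_num
    have e2 : e (38 / 144) = e (1 / 6) * e (5 / 144) * (e (1 / 24) * e (1 / 48)) *
        (e (1 / 48) * (e (-1 / 24) * e (1 / 48))) := by
      simp only [← e_add]
      refine e_eq_of_sub_int 0 ?_
      push_cast; norm_num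
    conv_lhs => rw [e1]
    conv_rhs => rw [e2]
    push_cast at h ⊢
    linear_combination h
  have h2 := mul_left_cancel₀ (e_ne_zero _) h1
  exact mul_right_cancel₀ hs.ne' (by exact_mod_cast h2)

/-- Jacobi's quartic relation at `(1/3, 1/3)`: after removing a common phase, the three
characteristics of the orbit each contribute `r⁴` with the same sign, and `θ_{5/6,5/6}` contributes
`s⁴`. -/
theorem theta_zeta_sixth_pow_four {r s : ℝ}
    (hr : theta (1 / 3) (1 / 3) 0 zeta = e (11 / 144) * r)
    (hs : theta (1 / 6) (1 / 6) 0 zeta = e (5 / 144) * s) : s ^ 4 = 3 * r ^ 4 := by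
  have h := theta_quartic (1 / 3) (1 / 3) zeta_im_pos
  rw [show (1 / 3 + 1 / 2 : ℝ) = 5 / 6 by norm_num, theta_five_sixths_five_sixths,
    theta_zeta_five_sixths_third, theta_zeta_third_five_sixths, hs, hr] at h
  have hneg : -e (44 / 144) = e (1 / 2) * e (44 / 144) := by rw [e_half]; ring
  have e1 : e (11 / 144) ^ 4 = e (44 / 144) := by
    rw [e_pow]; congr 1; norm_num
  have e2 : e (-2 * ((1 / 3 : ℝ) : ℂ)) * (e (42 / 144) * e (11 / 144)) ^ 4 = - e (44 / 144) := by
    rw [← e_add, e_pow, ← e_add, hneg, ← e_add]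
    refine e_eq_of_sub_int 0 ?_
    push_cast; norm_num
  have e3 : (e (-18 / 144) * e (11 / 144)) ^ 4 = - e (44 / 144) := by
    rw [← e_add, e_pow, hneg, ← e_add]
    refine e_eq_of_sub_int (-1) ?_
    push_cast; norm_num
  have e4 : e (-2 * ((1 / 3 : ℝ) : ℂ)) * (e (-1 / 6) * e (5 / 144)) ^ 4 = - e (44 / 144) := by
    rw [← e_add, e_pow, ← e_add, hneg, ← e_add]
    refine e_eq_of_sub_int (-2) ?_
    push_cast; norm_num
  have h1 : e (44 / 144) * (s ^ 4 : ℝ) = e (44 / 144) * (3 * r ^ 4 : ℝ) := by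
    push_cast
    linear_combination -h + r ^ 4 * e1 - r ^ 4 * e2 - r ^ 4 * e3 + s ^ 4 * e4
  exact_mod_cast mul_left_cancel₀ (e_ne_zero _) h1

/-- All the theta constants at `ζ` follow from the absolute value of `θ_{0,0}(0,ζ)`. -/
theorem theta_zeta_values
    (h : ‖theta 0 0 0 zeta‖ = (3 : ℝ) ^ (1 / 8 : ℝ) / ((4 : ℝ) ^ (1 / 3 : ℝ) * Real.pi) *
        Real.Gamma (1 / 3) ^ (3 / 2 : ℝ)) :
    theta 0 0 0 zeta =
      e (1 / 48) * ((3 : ℝ) ^ (1 / 8 : ℝ) / ((4 : ℝ) ^ (1 / 3 : ℝ) * Real.pi) *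
        Real.Gamma (1 / 3) ^ (3 / 2 : ℝ) : ℝ) ∧
    theta 0 (1 / 2) 0 zeta =
      e (-1 / 48) * ((3 : ℝ) ^ (1 / 8 : ℝ) / ((4 : ℝ) ^ (1 / 3 : ℝ) * Real.pi) *
        Real.Gamma (1 / 3) ^ (3 / 2 : ℝ) : ℝ) ∧
    theta (1 / 2) 0 0 zeta =
      e (1 / 16) * ((3 : ℝ) ^ (1 / 8 : ℝ) / ((4 : ℝ) ^ (1 / 3 : ℝ) * Real.pi) *
        Real.Gamma (1 / 3) ^ (3 / 2 : ℝ) : ℝ) ∧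
    theta (1 / 3) (1 / 3) 0 zeta =
      e (11 / 144) * ((3 : ℝ) ^ (1 / 8 : ℝ) / (2 * Real.pi) *
        Real.Gamma (1 / 3) ^ (3 / 2 : ℝ) : ℝ) ∧
    theta (1 / 6) (1 / 6) 0 zeta =
      e (5 / 144) * ((27 : ℝ) ^ (1 / 8 : ℝ) / (2 * Real.pi) *
        Real.Gamma (1 / 3) ^ (3 / 2 : ℝ) : ℝ) ∧
    theta (5 / 6) (1 / 3) 0 zeta =
      e (-7 / 144) * ((3 : ℝ) ^ (1 / 8 : ℝ) / (2 * Real.pi) *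
        Real.Gamma (1 / 3) ^ (3 / 2 : ℝ) : ℝ) ∧
    theta (1 / 3) (5 / 6) 0 zeta =
      e (53 / 144) * ((3 : ℝ) ^ (1 / 8 : ℝ) / (2 * Real.pi) *
        Real.Gamma (1 / 3) ^ (3 / 2 : ℝ) : ℝ) := by
  have h00 := theta_zeta_zero_zero
  obtain ⟨r, hr, hr'⟩ := exists_theta_zeta_third
  obtain ⟨s, hs, hs'⟩ := exists_theta_zeta_sixth
  have hsr := theta_zeta_sixth_pow_four hr' hs'
  rw [h] at h00 hr
  set G := Real.Gamma (1 / 3) ^ (3 / 2 : ℝ) with hG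
  have hG0 : 0 < G := Real.rpow_pos_of_pos (Real.Gamma_pos_of_pos (by norm_num)) _
  have hpi := Real.pi_pos
  have h4 : ((4 : ℝ) ^ (1 / 3 : ℝ)) ^ 3 = 4 := by
    rw [← Real.rpow_natCast, ← Real.rpow_mul (by norm_num)]; norm_num
  have h27 : ((27 : ℝ) ^ (1 / 8 : ℝ)) ^ 4 = 3 * ((3 : ℝ) ^ (1 / 8 : ℝ)) ^ 4 := by
    rw [← Real.rpow_natCast, ← Real.rpow_natCast, ← Real.rpow_mul (by norm_num),
      ← Real.rpow_mul (by norm_num), show (27 : ℝ) = 3 ^ (3 : ℝ) by norm_num,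
      ← Real.rpow_mul (by norm_num)]
    conv_rhs => rw [show (3 : ℝ) * 3 ^ ((1 / 8 : ℝ) * ((4 : ℕ) : ℝ)) =
      3 ^ (1 : ℝ) * 3 ^ ((1 / 8 : ℝ) * ((4 : ℕ) : ℝ)) by rw [Real.rpow_one],
      ← Real.rpow_add (by norm_num)]
    norm_num
  have h30 : (0 : ℝ) < 3 ^ (1 / 8 : ℝ) := Real.rpow_pos_of_pos (by norm_num) _
  have h40 : (0 : ℝ) < 4 ^ (1 / 3 : ℝ) := Real.rpow_pos_of_pos (by norm_num) _
  have h270 : (0 : ℝ) < 27 ^ (1 / 8 : ℝ) := Real.rpow_pos_of_pos (by norm_num) _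
  have hr2 : r = (3 : ℝ) ^ (1 / 8 : ℝ) / (2 * Real.pi) * G := by
    -- Cubing is injective on all of `ℝ`, so the sign of `r` need not be known beforehand.
    apply (Odd.strictMono_pow (n := 3) (by decide)).injective
    simp only
    have : 2 * r ^ 3 = 2 * ((3 : ℝ) ^ (1 / 8 : ℝ) / (2 * Real.pi) * G) ^ 3 := by
      rw [hr, mul_pow, div_pow, mul_pow, h4, mul_pow, div_pow, mul_pow]
      field_simp
      norm_num
    linarith
  have hs2 : s = (27 : ℝ) ^ (1 / 8 : ℝ) / (2 * Real.pi) * G := by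
    apply (pow_left_inj₀ hs.le (by positivity) (n := 4) (by norm_num)).1
    rw [hsr, hr2, mul_pow, div_pow, mul_pow, mul_pow, div_pow, mul_pow, h27]
    ring
  rw [hr2] at hr'
  rw [hs2] at hs'
  refine ⟨h00, ?_, ?_, hr', hs', ?_, ?_⟩
  · rw [theta_zeta_zero_half, h00, ← mul_assoc, ← e_add]; norm_num
  · rw [theta_zeta_half_zero, h00, ← mul_assoc, ← e_add]; norm_num
  · rw [theta_zeta_five_sixths_third, hr', ← mul_assoc, ← e_add]; norm_num
  · rw [theta_zeta_third_five_sixths, hr', ← mul_assoc, ← e_add]; norm_num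

end ZetaCurve

namespace ZetaCurve

open Complex ComplexConjugate

/-! ### The product of the even theta constants and the discriminant -/

open UpperHalfPlane hiding I
open ModularForm Filter MatrixGroups ModularGroup

/-- The eighth power of the product of the three even theta constants. -/
def thetaProduct (τ : ℍ) : ℂ :=
  (theta 0 0 0 τ * theta 0 (1 / 2) 0 τ * theta (1 / 2) 0 0 τ) ^ 8

/-- Translation exchanges `θ_{0,0}` and `θ_{0,1/2}` and multiplies `θ_{1/2,0}` by an eighth root of
unity, which the eighth power removes. -/
theorem thetaProduct_slash_T : thetaProduct ∣[(12 : ℤ)] T = thetaProduct := by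
  ext τ
  have h0 := theta_add_one_modulus 0 0 0 τ
  have h1 := theta_add_one_modulus 0 (1 / 2) 0 τ
  have h2 := theta_add_one_modulus (1 / 2) 0 0 τ
  have h3 := theta_add_one_right 0 0 0 τ
  have h4 := theta_add_one_right (1 / 2) 0 0 τ
  rw [show (0 + 0 + 1 / 2 : ℝ) = 1 / 2 by norm_num] at h0
  rw [show (0 + 1 / 2 + 1 / 2 : ℝ) = 0 + 1 by norm_num, h3] at h1
  rw [show (1 / 2 + 0 + 1 / 2 : ℝ) = 0 + 1 by norm_num, h4] at h2
  have e1 : (e (-(((1 / 2 : ℝ) : ℂ) ^ 2 + ((1 / 2 : ℝ) : ℂ)) / 2) * e ((1 / 2 : ℝ) : ℂ)) ^ 8 = 1 := by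
    rw [← e_add, e_pow, ← e_int 1]
    congr 1; push_cast; norm_num
  have e0 : e (-(((0 : ℝ) : ℂ) ^ 2 + ((0 : ℝ) : ℂ)) / 2) = 1 := by simp [e_zero]
  have e2 : e ((0 : ℝ) : ℂ) = 1 := by simp [e_zero]
  rw [e0] at h0 h1
  rw [e2] at h1
  have hT : ((T • τ : ℍ) : ℂ) = τ + 1 := by
    rw [modular_T_smul, coe_vadd, add_comm]; simp
  have hd : denom T τ = 1 := by
    rw [ModularGroup.denom_apply]; simp [ModularGroup.T]
  rw [SL_slash_apply, thetaProduct, hT, h0, h1, h2, thetaProduct, hd, one_zpow]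
  linear_combination (theta 0 0 0 τ * theta 0 (1 / 2) 0 τ * theta (1 / 2) 0 0 τ) ^ 8 * e1

/-- Inversion exchanges `θ_{0,1/2}` and `θ_{1/2,0}`. Each factor contributes a square root of `-iτ`;
its 24th power is `τ¹²`, the weight factor. -/
theorem thetaProduct_slash_S : thetaProduct ∣[(12 : ℤ)] S = thetaProduct := by
  ext τ
  have hτ := τ.im_pos
  have h0 := theta_neg_one_div 0 0 hτ
  have h1 := theta_neg_one_div 0 (1 / 2) hτ
  have h2 := theta_neg_one_div (1 / 2) 0 hτ
  have h3 := theta_add_one_right 0 (-(1 / 2)) 0 (-1 / τ)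
  rw [show (-(1 / 2) + 1 : ℝ) = 1 / 2 by norm_num] at h3
  simp only [ofReal_zero, e_zero, one_mul, mul_zero, zero_mul, neg_zero, mul_one] at h0 h1 h2 h3
  rw [← h3] at h2
  have hs : ((-I * τ) ^ (1 / 2 : ℂ)) ^ 24 = (τ : ℂ) ^ 12 := by
    rw [← Complex.cpow_nat_mul]
    rw [show ((24 : ℕ) : ℂ) * (1 / 2) = ((12 : ℕ) : ℂ) by norm_num, Complex.cpow_natCast,
      show (-I * (τ : ℂ)) ^ 12 = (I ^ 4) ^ 3 * (τ : ℂ) ^ 12 by ring, I_pow_four]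
    ring
  have hτ0 : (τ : ℂ) ≠ 0 := τ.ne_zero
  have hS : ((S • τ : ℍ) : ℂ) = -1 / τ := by
    rw [modular_S_smul]
    change (-(τ : ℂ))⁻¹ = _
    rw [inv_neg]; ring
  rw [SL_slash_apply, thetaProduct, hS, thetaProduct, h0, h1, h2, ModularGroup.denom_S]
  simp only [mul_pow, inv_pow, zpow_neg]
  rw [show ((τ : ℂ) ^ (12 : ℤ)) = (τ : ℂ) ^ 12 by norm_cast, ← hs]
  ring

theorem differentiableAt_theta (a b : ℝ) {τ : ℂ} (hτ : 0 < τ.im) :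
    DifferentiableAt ℂ (fun w => theta a b 0 w) τ := by
  have h : (fun w => theta a b 0 w) = fun w =>
      cexp (Real.pi * I * a ^ 2 * w + 2 * Real.pi * I * a * (0 + b)) *
      jacobiTheta₂ (0 + b + a * w) w := funext fun w => theta_eq_jacobiTheta₂ a b 0 w
  rw [h]
  refine DifferentiableAt.mul (by fun_prop) ?_
  exact ((hasFDerivAt_jacobiTheta₂ (0 + b + a * τ) hτ).differentiableAt).comp τ
    (f := fun w : ℂ => ((0 + b + a * w, w) : ℂ × ℂ)) (by fun_prop)

/-- Dominated convergence, with the values at `Im τ = 1` as majorant: only the terms with `m n = 0`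
survive. -/
theorem tendsto_tsum_exp_atImInfty (c : ℤ → ℂ) (m : ℤ → ℤ) (hc : ∀ n, ‖c n‖ ≤ 1)
    (hm : ∀ n, 0 ≤ m n) (hs : Summable fun n => Real.exp (-Real.pi * m n)) :
    Tendsto (fun τ : ℍ => ∑' n, c n * cexp (Real.pi * I * m n * τ)) atImInfty
      (𝓝 (∑' n, if m n = 0 then c n else 0)) := by
  have him : Tendsto (fun τ : ℍ => τ.im) atImInfty atTop := tendsto_comap
  have hnorm : ∀ (n : ℤ) (τ : ℍ), ‖cexp (Real.pi * I * m n * τ)‖ =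
      Real.exp (-Real.pi * m n * τ.im) := by
    intro n τ
    rw [Complex.norm_exp]
    congr 1
    rw [show (Real.pi * I * m n * τ : ℂ) = ((Real.pi * m n : ℝ) : ℂ) * (I * τ) by push_cast; ring,
      re_ofReal_mul]
    simp
  refine tendsto_tsum_of_dominated_convergence hs (fun n => ?_) ?_
  · by_cases h : m n = 0
    · simp [h]
    · rw [if_neg h]
      have hpos : (0 : ℝ) < m n := by exact_mod_cast lt_of_le_of_ne (hm n) (Ne.symm h)
      have : Tendsto (fun τ : ℍ => ‖cexp (Real.pi * I * m n * τ)‖) atImInfty (𝓝 0) := by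
        simp only [hnorm]
        refine Real.tendsto_exp_atBot.comp ?_
        refine him.const_mul_atTop_of_neg ?_
        nlinarith [Real.pi_pos]
      simpa using (tendsto_zero_iff_norm_tendsto_zero.2 this).const_mul (c n)
  · filter_upwards [him.eventually_ge_atTop 1] with τ hτ n
    rw [norm_mul, hnorm]
    calc _ ≤ 1 * Real.exp (-Real.pi * m n * τ.im) := by gcongr; exact hc n
      _ ≤ _ := by
        rw [one_mul]
        apply Real.exp_le_exp.2
        have : (0 : ℝ) ≤ m n := by exact_mod_cast hm n
        nlinarith [mul_nonneg Real.pi_pos.le this]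

theorem summable_exp_neg_pi_mul_sq :
    Summable fun n : ℤ => Real.exp (-Real.pi * ((n ^ 2 : ℤ) : ℝ)) := by
  refine (((summable_jacobiTheta₂_term_iff 0 I).2 (by simp)).norm).congr fun n => ?_
  rw [norm_jacobiTheta₂_term]; simp

theorem summable_exp_neg_pi_mul_sq_add :
    Summable fun n : ℤ => Real.exp (-Real.pi * ((n ^ 2 + n : ℤ) : ℝ)) := by
  refine (((summable_jacobiTheta₂_term_iff (I / 2) I).2 (by simp)).norm).congr fun n => ?_
  rw [norm_jacobiTheta₂_term]; simp; ring

theorem tendsto_theta_zero (b : ℝ) :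
    Tendsto (fun τ : ℍ => theta 0 b 0 τ) atImInfty (𝓝 1) := by
  have h := tendsto_tsum_exp_atImInfty (fun n => e (((n * b : ℝ)) : ℂ)) (fun n => n ^ 2)
    (fun n => (norm_e _).le) (fun n => sq_nonneg n) summable_exp_neg_pi_mul_sq
  have h1 : (∑' n : ℤ, if n ^ 2 = 0 then e (((n * b : ℝ)) : ℂ) else 0) = 1 := by
    rw [tsum_eq_single 0 (fun n hn => by simp [hn])]
    simp [e_zero]
  rw [h1] at h
  refine h.congr fun τ => tsum_congr fun n => ?_
  rw [e, ← Complex.exp_add]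
  congr 1
  push_cast; ring

/-- Since `(n + 1/2)² - 1/4 = n² + n`, the terms `n = 0` and `n = -1` survive. The eighth power of
this limit is the constant `256`. -/
theorem tendsto_theta_half :
    Tendsto (fun τ : ℍ => cexp (-(Real.pi * I * τ / 4)) * theta (1 / 2) 0 0 τ) atImInfty
      (𝓝 2) := by
  have hm : ∀ n : ℤ, 0 ≤ n ^ 2 + n := fun n => by
    rcases lt_or_ge n 0 with h | h <;> nlinarith
  have h := tendsto_tsum_exp_atImInfty (fun n => 1) (fun n => n ^ 2 + n)
    (fun n => by simp) hm summable_exp_neg_pi_mul_sq_add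
  have h1 : (∑' n : ℤ, if n ^ 2 + n = 0 then (1 : ℂ) else 0) = 2 := by
    rw [tsum_eq_sum (s := {0, -1})]
    · rw [Finset.sum_pair (by norm_num)]; norm_num
    · intro n hn
      rw [if_neg]
      intro h0
      have : n * (n + 1) = 0 := by linarith
      rcases mul_eq_zero.1 this with h' | h'
      · simp [h'] at hn
      · have : n = -1 := by omega
        simp [this] at hn
  rw [h1] at h
  refine h.congr fun τ => ?_
  rw [theta, ← tsum_mul_left]
  refine tsum_congr fun n => ?_
  rw [one_mul, ← Complex.exp_add]
  congr 1
  push_cast; ring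

theorem tendsto_thetaProduct_div :
    Tendsto (fun τ : ℍ => thetaProduct τ / Function.Periodic.qParam 1 τ) atImInfty (𝓝 256) := by
  have h := (((tendsto_theta_zero 0).mul (tendsto_theta_zero (1 / 2))).mul tendsto_theta_half).pow 8
  rw [show ((1 : ℂ) * 1 * 2) ^ 8 = 256 by norm_num] at h
  refine h.congr fun τ => ?_
  rw [thetaProduct, Function.Periodic.qParam, div_eq_mul_inv (b := cexp _), ← Complex.exp_neg]
  have h2 : cexp (-(2 * Real.pi * I * τ / ((1 : ℝ) : ℂ))) = cexp (-(Real.pi * I * τ / 4)) ^ 8 := by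
    rw [← Complex.exp_nat_mul]; congr 1; push_cast; ring
  rw [h2]
  ring

theorem tendsto_discriminant_div :
    Tendsto (fun τ : ℍ => discriminant τ / Function.Periodic.qParam 1 τ) atImInfty (𝓝 1) := by
  refine tendsto_atImInfty_tprod_one_sub_eta_q_pow.congr fun τ => ?_
  rw [discriminant_eq_q_prod, mul_div_cancel_left₀ _ (by
    rw [Function.Periodic.qParam]; exact Complex.exp_ne_zero _)]

theorem thetaProduct_isZeroAtImInfty : IsZeroAtImInfty thetaProduct := by
  have h := tendsto_thetaProduct_div.mul (qParam_tendsto_atImInfty zero_lt_one)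
  rw [mul_zero] at h
  refine Tendsto.congr (fun τ => ?_) h
  exact div_mul_cancel₀ _ (by rw [Function.Periodic.qParam]; exact Complex.exp_ne_zero _)

/-- The function `thetaProduct` as a cusp form. -/
def thetaProductCuspForm : CuspForm 𝒮ℒ 12 where
  toFun := thetaProduct
  slash_action_eq' A hA := by
    obtain ⟨A, rfl⟩ := hA
    exact SlashInvariantForm.slash_action_generators_SL2Z thetaProduct_slash_S thetaProduct_slash_T A
  holo' := by
    rw [UpperHalfPlane.mdifferentiable_iff]
    have : DifferentiableOn ℂ (fun w =>
        (theta 0 0 0 w * theta 0 (1 / 2) 0 w * theta (1 / 2) 0 0 w) ^ 8) upperHalfPlaneSet :=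
      fun w hw => ((((differentiableAt_theta 0 0 hw).mul (differentiableAt_theta 0 (1 / 2) hw)).mul
        (differentiableAt_theta (1 / 2) 0 hw)).pow 8).differentiableWithinAt
    refine this.congr fun w hw => ?_
    simp [thetaProduct, ofComplex_apply_of_im_pos hw]
  zero_at_cusps' hc := by
    rw [Subgroup.IsArithmetic.isCusp_iff_isCusp_SL2Z] at hc
    rw [OnePoint.isZeroAt_iff_forall_SL2Z hc]
    intro γ _
    rw [SlashInvariantForm.slash_action_generators_SL2Z thetaProduct_slash_S thetaProduct_slash_T]
    exact thetaProduct_isZeroAtImInfty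

/-- Cusp forms of weight 12 are multiples of the discriminant, and the leading coefficients at
infinity give the factor. -/
theorem thetaProduct_eq_discriminant (τ : ℍ) : thetaProduct τ = 256 * discriminant τ := by
  obtain ⟨c, hc⟩ := CuspForm.exists_smul_discriminant_of_weight_eq_twelve thetaProductCuspForm
  have h1 : ∀ τ, thetaProduct τ = c * discriminant τ := fun τ =>
    (DFunLike.congr_fun hc τ).symm
  have h2 := tendsto_discriminant_div.const_mul c
  have h3 : Tendsto (fun τ : ℍ => thetaProduct τ / Function.Periodic.qParam 1 τ) atImInfty
      (𝓝 (c * 1)) := h2.congr fun τ => by rw [h1, mul_div_assoc]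
  have h4 := tendsto_nhds_unique h3 tendsto_thetaProduct_div
  rw [h1, ← h4, mul_one]

/-- `ζ` as a point of the upper half plane. -/
def zetaPoint : ℍ := ⟨zeta, zeta_im_pos⟩

theorem norm_theta_zeta_pow :
    ‖theta 0 0 0 zeta‖ ^ 24 = 256 * ‖(E₄ zetaPoint ^ 3 - E₆ zetaPoint ^ 2) / 1728‖ := by
  have h := thetaProduct_eq_discriminant zetaPoint
  rw [discriminant_eq_E₄_cube_sub_E₆_sq] at h
  have h1 := congrArg norm h
  have h2 : ((zetaPoint : ℍ) : ℂ) = zeta := rfl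
  have e1 : ‖e (-1 / 24)‖ = 1 := by simpa using norm_e (-1 / 24)
  have e2 : ‖e (1 / 24)‖ = 1 := by simpa using norm_e (1 / 24)
  rw [thetaProduct, h2, theta_zeta_half_zero, theta_zeta_zero_half, norm_pow, norm_mul, norm_mul,
    norm_mul, norm_mul, e1, e2, norm_mul] at h1
  norm_num at h1 ⊢
  rw [← h1]; ring

/-! ### The hexagonal lattice -/

theorem linearIndependent_zeta_one : LinearIndependent ℝ ![zeta, 1] := by
  rw [LinearIndependent.pair_iff]
  intro s t h
  have h1 := congrArg Complex.im h
  have h2 := congrArg Complex.re h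
  simp only [real_smul, mul_one, add_im, im_ofReal_mul, add_re, re_ofReal_mul, ofReal_im,
    ofReal_re, zero_im, zero_re, add_zero] at h1 h2
  have hs : s = 0 := by
    rcases mul_eq_zero.1 h1 with h | h
    · exact h
    · exact absurd h zeta_im_pos.ne'
  subst hs
  simpa using h2

/-- The period pair `(ζ, 1)`. -/
def periodPair : PeriodPair where
  ω₁ := zeta
  ω₂ := 1
  indep := linearIndependent_zeta_one

theorem mem_periodPair_lattice {x : ℂ} :
    x ∈ periodPair.lattice ↔ ∃ m n : ℤ, m * zeta + n * 1 = x := PeriodPair.mem_lattice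

theorem mem_lattice_iff {x : ℂ} : x ∈ lattice ↔ x ∈ periodPair.lattice := by
  rw [lattice, mem_periodPair_lattice, AddSubgroup.mem_closure_pair]
  simp

theorem periodPair_G_eq {k : ℕ} (hk : 3 ≤ k) :
    periodPair.G k = 2 * riemannZeta k * E hk zetaPoint := by
  have h := tsum_eisSummand_eq_riemannZeta_mul_eisensteinSeries hk zetaPoint
  have h1 : E hk zetaPoint = (1 / 2 : ℂ) * eisensteinSeries (N := 1) 0 k zetaPoint := rfl
  rw [h1, show 2 * riemannZeta k * (1 / 2 * eisensteinSeries (N := 1) 0 k zetaPoint) =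
    riemannZeta k * eisensteinSeries (N := 1) 0 k zetaPoint by ring, ← h, PeriodPair.G,
    ← (finTwoArrowEquiv ℤ).symm.tsum_eq, ← periodPair.latticeEquivProd.symm.toEquiv.tsum_eq]
  refine tsum_congr fun p => ?_
  have h2 := periodPair.latticeEquiv_symm_apply p
  simp only [LinearEquiv.coe_toEquiv]
  rw [h2]
  simp [EisensteinSeries.eisSummand, periodPair, zetaPoint]

theorem zeta_mul_mem {x : ℂ} (hx : x ∈ periodPair.lattice) : zeta * x ∈ periodPair.lattice := by
  rw [mem_periodPair_lattice] at *
  obtain ⟨m, n, rfl⟩ := hx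
  exact ⟨m + n, -m, by push_cast; linear_combination -m * zeta_sq⟩

theorem zeta_inv : zeta⁻¹ = 1 - zeta :=
  inv_eq_of_mul_eq_one_right (by linear_combination -zeta_sq)

theorem zeta_inv_mul_mem {x : ℂ} (hx : x ∈ periodPair.lattice) :
    zeta⁻¹ * x ∈ periodPair.lattice := by
  rw [zeta_inv, sub_mul, one_mul]
  exact sub_mem hx (zeta_mul_mem hx)

/-- Multiplication by `ζ` as a permutation of the lattice. -/
def zetaMul : periodPair.lattice ≃ periodPair.lattice where
  toFun x := ⟨zeta * x, zeta_mul_mem x.2⟩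
  invFun x := ⟨zeta⁻¹ * x, zeta_inv_mul_mem x.2⟩
  left_inv x := by ext; simp [zeta_ne_zero]
  right_inv x := by ext; simp [zeta_ne_zero]

theorem zeta_cube : zeta ^ 3 = -1 := by
  linear_combination (zeta + 1) * zeta_sq

/-- Reindexing the lattice sum by `ζ` multiplies it by `ζ⁻⁴ = -ζ⁻¹ ≠ 1`. -/
theorem periodPair_G_four : periodPair.G 4 = 0 := by
  have h : periodPair.G 4 = -zeta⁻¹ * periodPair.G 4 := by
    conv_lhs => rw [PeriodPair.G, ← zetaMul.tsum_eq]
    rw [PeriodPair.G, ← tsum_mul_left]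
    refine tsum_congr fun l => ?_
    simp only [zetaMul, Equiv.coe_fn_mk, mul_pow, mul_inv]
    rw [show zeta ^ 4 = -zeta by rw [pow_succ, zeta_cube]; ring, inv_neg]
  have h2 : (1 + zeta⁻¹) * periodPair.G 4 = 0 := by linear_combination h
  rcases mul_eq_zero.1 h2 with h3 | h3
  · rw [zeta_inv] at h3
    have := congrArg Complex.im h3
    simp at this
    exact absurd this zeta_im_pos.ne'
  · exact h3

theorem E₄_zetaPoint : E₄ zetaPoint = 0 := by
  have h := periodPair_G_eq (k := 4) (by norm_num)
  rw [periodPair_G_four] at h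
  have hz : riemannZeta (4 : ℕ) ≠ 0 := riemannZeta_ne_zero_of_one_lt_re (by simp)
  rcases mul_eq_zero.1 h.symm with h1 | h1
  · exact absurd h1 (mul_ne_zero two_ne_zero hz)
  · exact h1

theorem riemannZeta_six : riemannZeta 6 = Real.pi ^ 6 / 945 := by
  have h := riemannZeta_two_mul_nat (k := 3) (by norm_num)
  rw [show bernoulli (2 * 3) = 1 / 42 by decide +kernel] at h
  norm_num [Nat.factorial] at h
  rw [h]; ring

theorem norm_theta_zeta_pow_eq :
    ‖theta 0 0 0 zeta‖ ^ 24 = 27 * ‖periodPair.g₃‖ ^ 2 / (16 * Real.pi ^ 12) := by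
  have h := periodPair_G_eq (k := 6) (by norm_num)
  have h6 : ((6 : ℕ) : ℂ) = 6 := by norm_num
  rw [h6, riemannZeta_six] at h
  have hpi : (0 : ℝ) < Real.pi := Real.pi_pos
  rw [norm_theta_zeta_pow, E₄_zetaPoint, PeriodPair.g₃, h]
  simp only [norm_mul, norm_div, norm_pow, zero_pow (n := 3) (by norm_num), zero_sub, norm_neg,
    norm_real, Real.norm_of_nonneg hpi.le]
  norm_num
  field_simp
  ring

end ZetaCurve

namespace ZetaCurve

open Complex ComplexConjugate Filter PeriodPair

/-! ### The Weierstrass function of the hexagonal lattice -/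

local notation "Λ" => PeriodPair.lattice periodPair
local notation "℘" => PeriodPair.weierstrassP periodPair
local notation "℘₁" => PeriodPair.derivWeierstrassP periodPair

theorem countable_lattice : (Λ : Set ℂ).Countable := by
  have : Countable Λ := periodPair.latticeEquivProd.toEquiv.countable_iff.2 inferInstance
  exact Set.to_countable _

theorem isOpen_compl_lattice : IsOpen ((Λ : Set ℂ)ᶜ) := periodPair.isClosed_lattice.isOpen_compl

theorem isPreconnected_compl_of_countable {s : Set ℂ} (hs : s.Countable) : IsPreconnected sᶜ :=
  (hs.isConnected_compl_of_one_lt_rank (by rw [Complex.rank_real_complex]; norm_num)).isPreconnected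

theorem hasDerivAt_wp {z : ℂ} (hz : z ∉ Λ) : HasDerivAt ℘ (℘₁ z) z := by
  rw [← periodPair.deriv_weierstrassP]
  exact ((periodPair.analyticOnNhd_weierstrassP z hz).differentiableAt).hasDerivAt

theorem wp'_sq {z : ℂ} (hz : z ∉ Λ) : ℘₁ z ^ 2 = 4 * ℘ z ^ 3 - periodPair.g₃ := by
  rw [periodPair.derivWeierstrassP_sq z hz, PeriodPair.g₂, periodPair_G_four]; ring

theorem tendsto_wp {l : ℂ} (hl : l ∈ Λ) : Tendsto ℘ (𝓝[≠] l) (Bornology.cobounded ℂ) :=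
  tendsto_cobounded_of_meromorphicOrderAt_neg (by
    rw [periodPair.order_weierstrassP l hl]; decide)

theorem eventually_notMem_lattice (z : ℂ) : ∀ᶠ w in 𝓝[≠] z, w ∉ Λ := by
  filter_upwards [mem_nhdsWithin_of_mem_nhds
    (periodPair.compl_lattice_sdiff_singleton_mem_nhds z), self_mem_nhdsWithin] with w h1 h2 h3
  exact h1 ⟨h3, h2⟩

/-- Differentiating `℘'² = 4℘³ - g₃` gives `℘'(℘'' - 6℘²) = 0`. On the connected complement of the
lattice one factor vanishes identically; it is not `℘'`, since then `℘³` would be constant despite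
the pole. -/
theorem hasDerivAt_wp' {z : ℂ} (hz : z ∉ Λ) : HasDerivAt ℘₁ (6 * ℘ z ^ 2) z := by
  have hP := periodPair.analyticOnNhd_weierstrassP
  have hP' := periodPair.analyticOnNhd_derivWeierstrassP
  have hmul : ∀ w ∈ (Λ : Set ℂ)ᶜ, ℘₁ w * (deriv ℘₁ w - 6 * ℘ w ^ 2) = 0 := by
    intro w hw
    have h1 : HasDerivAt (fun s => ℘₁ s ^ 2) (2 * ℘₁ w * deriv ℘₁ w) w := by
      simpa using ((hP' w hw).differentiableAt.hasDerivAt).fun_pow 2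
    have h2 : HasDerivAt (fun s => 4 * ℘ s ^ 3 - periodPair.g₃)
        (4 * (3 * ℘ w ^ 2 * ℘₁ w)) w := by
      simpa using (((hasDerivAt_wp hw).fun_pow 3).const_mul 4).sub_const periodPair.g₃
    have h3 : (fun s => ℘₁ s ^ 2) =ᶠ[𝓝 w] fun s => 4 * ℘ s ^ 3 - periodPair.g₃ := by
      filter_upwards [isOpen_compl_lattice.mem_nhds hw] with s hs using wp'_sq hs
    have h4 := (h1.congr_of_eventuallyEq h3.symm).unique h2
    linear_combination h4 / 2
  have hor := AnalyticOnNhd.eq_zero_or_eq_zero_of_mul_eq_zero hP'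
    (hP'.deriv.sub (analyticOnNhd_const.mul (hP.pow 2)))
    hmul (isPreconnected_compl_of_countable countable_lattice)
  rcases hor with h | h
  · exfalso
    have h1 : ∀ᶠ w in 𝓝[≠] (0 : ℂ), ‖periodPair.g₃‖ + 1 < ‖℘ w‖ :=
      (tendsto_norm_cobounded_atTop.comp (tendsto_wp (zero_mem _))).eventually_gt_atTop _
    obtain ⟨w, hw, hw'⟩ := (h1.and (eventually_notMem_lattice 0)).exists
    have h2 := wp'_sq hw'
    rw [h w hw'] at h2
    have h3 : ‖periodPair.g₃‖ = 4 * ‖℘ w‖ ^ 3 := by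
      have : periodPair.g₃ = 4 * ℘ w ^ 3 := by linear_combination h2
      rw [this, norm_mul, norm_pow]; norm_num
    have h4 : 1 ≤ ‖℘ w‖ := by linarith [norm_nonneg periodPair.g₃]
    have h5 : ‖℘ w‖ ≤ ‖℘ w‖ ^ 3 := le_self_pow₀ h4 (by norm_num)
    linarith
  · have h1 := (hP' z hz).differentiableAt.hasDerivAt
    have h2 : deriv ℘₁ z - 6 * ℘ z ^ 2 = 0 := h z hz
    rwa [sub_eq_zero.1 h2] at h1

/-- A solution of a linear second order equation with vanishing initial values vanishes. -/
theorem eventually_eq_zero_of_deriv_deriv {F h : ℂ → ℂ} {z : ℂ} (hF : AnalyticAt ℂ F z)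
    (hh : AnalyticAt ℂ h z) (h0 : F z = 0) (h1 : deriv F z = 0)
    (h2 : deriv (deriv F) =ᶠ[𝓝 z] h * F) : ∀ᶠ w in 𝓝 z, F w = 0 := by
  rw [← analyticOrderAt_eq_top]
  by_contra hne
  obtain ⟨n, hn⟩ := ENat.ne_top_iff_exists.1 hne
  -- Two differentiations lower the order `n` of the zero by exactly two, yet `h * F` has order at
  -- least `n`.
  have e1 := hF.analyticOrderAt_deriv_add_one
  have e2 := hF.deriv.analyticOrderAt_deriv_add_one
  simp only [h0, h1, sub_zero] at e1 e2
  rw [analyticOrderAt_congr h2, analyticOrderAt_mul hh hF] at e2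
  change analyticOrderAt (deriv F) z + 1 = analyticOrderAt F z at e1
  change _ = analyticOrderAt (deriv F) z at e2
  rw [← e2, ← hn] at e1
  have : (n : ℕ∞) + 2 ≤ n := by
    calc (n : ℕ∞) + 2 ≤ analyticOrderAt h z + n + 1 + 1 := by
          rw [add_assoc _ 1 1, one_add_one_eq_two]
          gcongr
          exact le_add_self
      _ = n := e1
  norm_cast at this
  omega

/-- A point of `ℂ / Λ` is determined by its image on the curve. -/
theorem sub_mem_of_wp_eq {z w : ℂ} (hz : z ∉ Λ) (hw : w ∉ Λ) (h : ℘ z = ℘ w) (h' : ℘₁ z = ℘₁ w) :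
    w - z ∈ Λ := by
  by_contra hd
  set d := w - z with hd_def
  have hP := periodPair.analyticOnNhd_weierstrassP
  have hzd : z + d = w := by rw [hd_def]; ring
  have hshift : ∀ s, s + d ∉ Λ → AnalyticAt ℂ (fun s => ℘ (s + d)) s := fun s hs =>
    (hP (s + d) hs).comp_of_eq (by fun_prop) rfl
  have hds : ∀ s, s + d ∉ Λ → HasDerivAt (fun s => ℘ (s + d)) (℘₁ (s + d)) s := fun s hs =>
    (hasDerivAt_wp hs).comp_add_const s d
  have hds' : ∀ s, s + d ∉ Λ → HasDerivAt (fun s => ℘₁ (s + d)) (6 * ℘ (s + d) ^ 2) s :=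
    fun s hs => (hasDerivAt_wp' hs).comp_add_const s d
  have hopen : IsOpen ((fun s : ℂ => s + d) ⁻¹' (Λ : Set ℂ)ᶜ) :=
    isOpen_compl_lattice.preimage (by fun_prop)
  set U : Set ℂ := (Λ : Set ℂ)ᶜ ∩ (fun s : ℂ => s + d) ⁻¹' (Λ : Set ℂ)ᶜ with hU
  have hUo : IsOpen U := isOpen_compl_lattice.inter hopen
  have hzU : z ∈ U := ⟨hz, by simpa [hzd] using hw⟩
  have hUc : IsPreconnected U := by
    have : U = ((Λ : Set ℂ) ∪ (fun s : ℂ => s + d) ⁻¹' (Λ : Set ℂ))ᶜ := by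
      rw [hU, compl_union, preimage_compl]
    rw [this]
    exact isPreconnected_compl_of_countable
      (countable_lattice.union (countable_lattice.preimage (add_left_injective d)))
  -- The difference `F(s) = ℘(s) - ℘(s + d)` satisfies `F'' = 6(℘(s) + ℘(s + d)) F` with vanishing
  -- initial values at `z`. So `d` is a period of `℘` on `U`, which is impossible near the pole `0`
  -- because `d ∉ Λ`.
  have hev := eventually_eq_zero_of_deriv_deriv (F := fun s => ℘ s - ℘ (s + d))
    (h := fun s => 6 * (℘ s + ℘ (s + d))) (z := z)
    ((hP z hz).sub (hshift z hzU.2))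
    (analyticAt_const.mul ((hP z hz).add (hshift z hzU.2)))
    (by simp [hzd, h]) (by
      rw [((hasDerivAt_wp hz).fun_sub (hds z hzU.2)).deriv, hzd, h', sub_self])
    (by
      have h1 : ∀ s ∈ U, deriv (fun s => ℘ s - ℘ (s + d)) s = ℘₁ s - ℘₁ (s + d) := fun s hs =>
        ((hasDerivAt_wp hs.1).fun_sub (hds s hs.2)).deriv
      filter_upwards [hUo.mem_nhds hzU] with s hs
      have h2 : deriv (fun s => ℘ s - ℘ (s + d)) =ᶠ[𝓝 s] fun s => ℘₁ s - ℘₁ (s + d) := by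
        filter_upwards [hUo.mem_nhds hs] with r hr using h1 r hr
      rw [h2.deriv_eq, ((hasDerivAt_wp' hs.1).fun_sub (hds' s hs.2)).deriv]
      simp only [Pi.mul_apply]
      ring)
  have heq : EqOn ℘ (fun s => ℘ (s + d)) U :=
    AnalyticOnNhd.eqOn_of_preconnected_of_eventuallyEq (fun s hs => hP s hs.1)
      (fun s hs => hshift s hs.2) hUc hzU (by
        filter_upwards [hev] with s hs using sub_eq_zero.1 hs)
  have h0 : (0 : ℂ) + d ∉ Λ := by rwa [zero_add]
  have hc : Tendsto (fun s => ℘ (s + d)) (𝓝[≠] 0) (𝓝 (℘ (0 + d))) :=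
    (hshift 0 h0).continuousAt.tendsto.mono_left nhdsWithin_le_nhds
  have hc' : Tendsto ℘ (𝓝[≠] 0) (𝓝 (℘ (0 + d))) := by
    refine hc.congr' ?_
    filter_upwards [eventually_notMem_lattice 0,
      mem_nhdsWithin_of_mem_nhds (hopen.mem_nhds h0)] with s h1 h2
    exact (heq ⟨h1, h2⟩).symm
  exact not_tendsto_nhds_of_tendsto_atTop
    (tendsto_norm_cobounded_atTop.comp (tendsto_wp (zero_mem _))) _ hc'.norm

/-- If `℘` omitted `a`, then `1/(℘ - a)`, extended by `0` over the lattice, would be entire,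
periodic and hence bounded. By Liouville it would be identically `0`, which an inverse cannot be. -/
theorem exists_wp_eq (a : ℂ) : ∃ z, z ∉ Λ ∧ ℘ z = a := by
  classical
  by_contra! hne
  set f : ℂ → ℂ := fun z => if z ∈ Λ then 0 else (℘ z - a)⁻¹ with hf
  have hfe : ∀ z ∉ Λ, f =ᶠ[𝓝 z] fun w => (℘ w - a)⁻¹ := fun z hz => by
    filter_upwards [isOpen_compl_lattice.mem_nhds hz] with w hw
    exact if_neg hw
  have hd1 : ∀ z ∉ Λ, DifferentiableAt ℂ f z := fun z hz =>
    ((((hasDerivAt_wp hz).differentiableAt.sub_const a).inv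
      (sub_ne_zero.2 (hne z hz))).congr_of_eventuallyEq (hfe z hz))
  have hd : Differentiable ℂ f := by
    intro z
    by_cases hz : z ∈ Λ
    · refine (Complex.analyticAt_of_differentiable_on_punctured_nhds_of_continuousAt
        ((eventually_notMem_lattice z).mono hd1) ?_).differentiableAt
      rw [continuousAt_iff_punctured_nhds, show f z = 0 from if_pos hz]
      have h1 : Tendsto (fun w => (℘ w - a)⁻¹) (𝓝[≠] z) (𝓝 0) :=
        tendsto_inv₀_cobounded.comp
          ((tendsto_sub_const_cobounded a).comp (tendsto_wp hz))
      refine h1.congr' ?_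
      filter_upwards [eventually_notMem_lattice z] with w hw
      exact (if_neg hw).symm
    · exact hd1 z hz
  have hper : ∀ z w : ℂ, w ∈ Λ → f (z + w) = f z := by
    intro z w hw
    have h1 : z + w ∈ Λ ↔ z ∈ Λ := Submodule.add_mem_iff_left _ hw
    have h2 : ℘ (z + w) = ℘ z := periodPair.weierstrassP_add_coe z ⟨w, hw⟩
    simp only [hf, h1, h2]
  obtain ⟨w, hw⟩ := (eventually_notMem_lattice 0).exists
  have h1 := hd.apply_eq_apply_of_bounded
    (IsZLattice.isCompact_range_of_periodic Λ f hd.continuous hper).isBounded w 0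
  rw [show f 0 = 0 from if_pos (zero_mem _), show f w = (℘ w - a)⁻¹ from if_neg hw] at h1
  exact inv_ne_zero (sub_ne_zero.2 (hne w hw)) h1

theorem wp_zeta_mul (z : ℂ) : ℘ (zeta * z) = (zeta ^ 2)⁻¹ * ℘ z := by
  rw [PeriodPair.weierstrassP, PeriodPair.weierstrassP, ← tsum_mul_left, ← zetaMul.tsum_eq]
  refine tsum_congr fun l => ?_
  simp only [zetaMul, Equiv.coe_fn_mk]
  rw [← mul_sub, mul_pow, mul_pow]
  simp only [one_div, mul_inv]
  ring

theorem wp'_zeta_mul (z : ℂ) : ℘₁ (zeta * z) = -℘₁ z := by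
  rw [PeriodPair.derivWeierstrassP, PeriodPair.derivWeierstrassP, neg_inj, ← tsum_neg,
    ← zetaMul.tsum_eq]
  refine tsum_congr fun l => ?_
  simp only [zetaMul, Equiv.coe_fn_mk]
  rw [← mul_sub, mul_pow, zeta_cube, neg_one_mul, div_neg]

theorem conj_mem {x : ℂ} (hx : x ∈ Λ) : conj x ∈ Λ := by
  rw [mem_periodPair_lattice] at *
  obtain ⟨m, n, rfl⟩ := hx
  refine ⟨-m, m + n, ?_⟩
  simp only [map_add, map_mul, map_intCast, conj_zeta, map_one]
  push_cast; ring

/-- Complex conjugation as a permutation of the lattice. -/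
def conjEquiv : Λ ≃ Λ where
  toFun x := ⟨conj x, conj_mem x.2⟩
  invFun x := ⟨conj x, conj_mem x.2⟩
  left_inv x := by ext; simp
  right_inv x := by ext; simp

theorem conj_wp (z : ℂ) : conj (℘ z) = ℘ (conj z) := by
  rw [PeriodPair.weierstrassP, PeriodPair.weierstrassP, Complex.conj_tsum, ← conjEquiv.tsum_eq]
  refine tsum_congr fun l => ?_
  simp [conjEquiv]

/-! ### The real period -/

theorem ofReal_mem_lattice {x : ℝ} (hx : (x : ℂ) ∈ Λ) : ∃ n : ℤ, x = n := by
  rw [mem_periodPair_lattice] at hx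
  obtain ⟨m, n, h⟩ := hx
  have h1 := congrArg Complex.im h
  simp [zeta_im_pos.ne'] at h1
  refine ⟨n, ?_⟩
  rw [h1] at h
  have h2 := congrArg Complex.re h
  simpa using h2.symm

theorem ofReal_notMem_lattice {x : ℝ} (h0 : 0 < x) (h1 : x < 1) : (x : ℂ) ∉ Λ := by
  intro h
  obtain ⟨n, rfl⟩ := ofReal_mem_lattice h
  have h2 : 0 < n := by exact_mod_cast h0
  have h3 : n < 1 := by exact_mod_cast h1
  omega

/-- At a zero of `℘`, the points `x` and `ζ²x` have the same image under `(℘, ℘')`, so `(ζ² - 1)x =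
xζ - 2x` lies in `Λ` and `x` is an integer. -/
theorem wp_ofReal_ne_zero {x : ℝ} (h0 : 0 < x) (h1 : x < 1) : ℘ x ≠ 0 := by
  intro h
  have hx := ofReal_notMem_lattice h0 h1
  have hx2 : zeta * (zeta * x) ∉ Λ := fun hm => hx (by
    have := zeta_inv_mul_mem (zeta_inv_mul_mem hm)
    rwa [inv_mul_cancel_left₀ zeta_ne_zero, inv_mul_cancel_left₀ zeta_ne_zero] at this)
  have hm := sub_mem_of_wp_eq hx hx2 (by rw [wp_zeta_mul, wp_zeta_mul, h]; simp)
    (by rw [wp'_zeta_mul, wp'_zeta_mul, neg_neg])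
  rw [mem_periodPair_lattice] at hm
  obtain ⟨m, n, hmn⟩ := hm
  have h2 : (m : ℂ) * zeta + n * 1 = x * zeta - 2 * x := by
    rw [hmn]; linear_combination (x : ℂ) * zeta_sq
  have h3 := congrArg Complex.im h2
  simp at h3
  have h4 : (m : ℝ) = x := by
    rcases h3 with h3 | h3
    · exact h3
    · exact absurd h3 zeta_im_pos.ne'
  have h5 : 0 < m := by exact_mod_cast h4 ▸ h0
  have h6 : m < 1 := by exact_mod_cast h4 ▸ h1
  omega

theorem wp'_half : ℘₁ ((1 / 2 : ℝ) : ℂ) = 0 := by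
  have h1 : (1 : ℂ) ∈ Λ := mem_periodPair_lattice.2 ⟨0, 1, by simp⟩
  have h2 := periodPair.derivWeierstrassP_add_coe (-((1 / 2 : ℝ) : ℂ)) ⟨1, h1⟩
  rw [periodPair.derivWeierstrassP_neg] at h2
  have h3 : -((1 / 2 : ℝ) : ℂ) + 1 = ((1 / 2 : ℝ) : ℂ) := by push_cast; norm_num
  simp only [h3] at h2
  exact self_eq_neg.1 h2

/-- The Weierstrass function on the real line. -/
def realWp (x : ℝ) : ℝ := (℘ x).re

theorem ofReal_realWp (x : ℝ) : ((realWp x : ℝ) : ℂ) = ℘ x := by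
  have h := conj_wp x
  rw [conj_ofReal] at h
  exact Complex.conj_eq_iff_re.1 h

/-- The derivative of the Weierstrass function on the real line. -/
def realWp' (x : ℝ) : ℝ := (℘₁ x).re

theorem hasDerivAt_realWp {x : ℝ} (h0 : 0 < x) (h1 : x < 1) :
    HasDerivAt realWp (realWp' x) x :=
  (hasDerivAt_wp (ofReal_notMem_lattice h0 h1)).real_of_complex

theorem ofReal_realWp' {x : ℝ} (h0 : 0 < x) (h1 : x < 1) : ((realWp' x : ℝ) : ℂ) = ℘₁ x := by
  have h2 : HasDerivAt (fun y : ℝ => ((realWp y : ℝ) : ℂ)) (℘₁ x) x := by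
    simp only [ofReal_realWp]
    exact (hasDerivAt_wp (ofReal_notMem_lattice h0 h1)).comp_ofReal
  exact (hasDerivAt_realWp h0 h1).ofReal_comp.unique h2

/-- The value of the Weierstrass function at the real half period. -/
def halfValue : ℝ := realWp (1 / 2)

theorem g₃_eq : periodPair.g₃ = ((4 * halfValue ^ 3 : ℝ) : ℂ) := by
  have h := wp'_sq (ofReal_notMem_lattice (x := 1 / 2) (by norm_num) (by norm_num))
  rw [wp'_half, ← ofReal_realWp] at h
  push_cast
  rw [halfValue]
  linear_combination h

theorem realWp'_sq {x : ℝ} (h0 : 0 < x) (h1 : x < 1) :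
    realWp' x ^ 2 = 4 * (realWp x ^ 3 - halfValue ^ 3) := by
  have h := wp'_sq (ofReal_notMem_lattice h0 h1)
  rw [← ofReal_realWp' h0 h1, ← ofReal_realWp, g₃_eq] at h
  have : realWp' x ^ 2 = 4 * realWp x ^ 3 - 4 * halfValue ^ 3 := by exact_mod_cast h
  rw [this]; ring

/-- Equal values of `℘` force `℘'(x) = ±℘'(y)`, hence `y ≡ ±x` modulo `Λ`. The minus sign leaves
only `x + y = 1`, so `x = y = 1/2`. -/
theorem realWp_injOn : InjOn realWp (Ioc 0 (1 / 2)) := by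
  rintro x ⟨hx0, hx1⟩ y ⟨hy0, hy1⟩ h
  have hx := ofReal_notMem_lattice hx0 (by linarith)
  have hy := ofReal_notMem_lattice hy0 (by linarith)
  have h1 : ℘ x = ℘ y := by rw [← ofReal_realWp, ← ofReal_realWp, h]
  have h2 : ℘₁ x ^ 2 = ℘₁ y ^ 2 := by rw [wp'_sq hx, wp'_sq hy, h1]
  rcases sq_eq_sq_iff_eq_or_eq_neg.1 h2 with h3 | h3
  · obtain ⟨n, hn⟩ := ofReal_mem_lattice (x := y - x) (by
      push_cast; exact sub_mem_of_wp_eq hx hy h1 h3)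
    have : n = 0 := by
      have a1 : (n : ℝ) < 1 := by linarith
      have a2 : (-1 : ℝ) < n := by linarith
      have a3 : n < 1 := by exact_mod_cast a1
      have a4 : -1 < n := by exact_mod_cast a2
      omega
    rw [this] at hn; push_cast at hn; linarith
  · obtain ⟨n, hn⟩ := ofReal_mem_lattice (x := -y - x) (by
      push_cast
      refine sub_mem_of_wp_eq hx (fun hm => hy (by simpa using neg_mem hm)) ?_ ?_
      · rw [periodPair.weierstrassP_neg, h1]
      · rw [periodPair.derivWeierstrassP_neg, h3])
    have : n = -1 := by
      have a1 : (n : ℝ) < 0 := by linarith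
      have a2 : (-1 : ℝ) ≤ n := by linarith
      have a3 : n < 0 := by exact_mod_cast a1
      have a4 : -1 ≤ n := by exact_mod_cast a2
      omega
    rw [this] at hn; push_cast at hn; linarith

theorem tendsto_realWp : Tendsto realWp (𝓝[>] 0) atTop := by
  have h1 : ContinuousAt (periodPair.weierstrassPExcept 0) 0 :=
    (periodPair.analyticAt_weierstrassPExcept 0).continuousAt
  have h2 : ∀ x : ℝ, realWp x = (periodPair.weierstrassPExcept 0 x).re + (x ^ 2)⁻¹ := by
    intro x
    have h := periodPair.weierstrassPExcept_def 0 x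
    simp only [ZeroMemClass.coe_zero] at h
    rw [h, realWp, ← ofReal_zero, ← ofReal_sub, ← ofReal_pow, ← ofReal_pow]
    simp only [add_re]
    rw [← ofReal_one, ← ofReal_div, ← ofReal_div, ← ofReal_sub, ofReal_re]
    simp
  have h3 : Tendsto (fun x : ℝ => (periodPair.weierstrassPExcept 0 x).re) (𝓝[>] 0)
      (𝓝 (periodPair.weierstrassPExcept 0 0).re) := by
    have h4 : ContinuousAt (fun x : ℝ => (periodPair.weierstrassPExcept 0 x).re) 0 :=
      continuous_re.continuousAt.comp
        (ContinuousAt.comp_of_eq h1 continuous_ofReal.continuousAt ofReal_zero)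
    simpa using h4.tendsto.mono_left nhdsWithin_le_nhds
  have h5 : Tendsto (fun x : ℝ => (x ^ 2)⁻¹) (𝓝[>] 0) atTop := by
    refine tendsto_inv_nhdsGT_zero.comp (tendsto_nhdsWithin_iff.2 ⟨?_, ?_⟩)
    · have : Tendsto (fun x : ℝ => x ^ 2) (𝓝 0) (𝓝 (0 ^ 2)) := (continuous_pow 2).tendsto 0
      simpa using this.mono_left nhdsWithin_le_nhds
    · filter_upwards [self_mem_nhdsWithin] with x hx
      exact pow_pos (mem_Ioi.1 hx) 2
  exact (h3.add_atTop h5).congr fun x => (h2 x).symm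

theorem continuousOn_realWp : ContinuousOn realWp (Ioc 0 (1 / 2)) := fun x hx =>
  (hasDerivAt_realWp hx.1 (by linarith [hx.2])).continuousAt.continuousWithinAt

/-- `℘` is positive near `0` and has no zero on the interval, so a nonpositive value would
contradict the intermediate value theorem. -/
theorem realWp_pos {x : ℝ} (hx : x ∈ Ioc (0 : ℝ) (1 / 2)) : 0 < realWp x := by
  by_contra! hneg
  have h1 : ∀ᶠ y in 𝓝[>] (0 : ℝ), 0 < realWp y := tendsto_realWp.eventually_gt_atTop 0
  have h2 : ∀ᶠ y in 𝓝[>] (0 : ℝ), y ∈ Ioo 0 x := Ioo_mem_nhdsGT hx.1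
  obtain ⟨y, hy, hy'⟩ := (h1.and h2).exists
  have hsub : Icc y x ⊆ Ioc (0 : ℝ) (1 / 2) := fun w hw =>
    ⟨hy'.1.trans_le hw.1, hw.2.trans hx.2⟩
  obtain ⟨w, hw, hw0⟩ := intermediate_value_Icc' hy'.2.le (continuousOn_realWp.mono hsub)
    ⟨hneg, hy.le⟩
  have hw' := hsub hw
  refine wp_ofReal_ne_zero hw'.1 (by linarith [hw'.2]) ?_
  rw [← ofReal_realWp, hw0, ofReal_zero]

theorem halfValue_pos : 0 < halfValue := realWp_pos ⟨by norm_num, le_rfl⟩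

end ZetaCurve

namespace ZetaCurve

open Complex ComplexConjugate Filter PeriodPair

/-! ### The real half period as a beta integral -/

/-- The function `(℘(1/2) / ℘(s))³`, which substitutes the beta integral for the real period. -/
def substitution (s : ℝ) : ℝ := (halfValue * (realWp s)⁻¹) ^ 3

/-- The conventional value at the pole is harmless: with `0⁻¹ = 0` it makes `substitution`
continuous at `0`. -/
theorem realWp_zero : realWp 0 = 0 := by
  simp [realWp, PeriodPair.weierstrassP]

theorem substitution_zero : substitution 0 = 0 := by
  simp [substitution, realWp_zero]

theorem substitution_half : substitution (1 / 2) = 1 := by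
  rw [substitution, ← halfValue, mul_inv_cancel₀ halfValue_pos.ne', one_pow]

theorem continuousOn_substitution : ContinuousOn substitution (Icc 0 (1 / 2)) := by
  intro x hx
  rcases hx.1.eq_or_lt with rfl | h0
  · have h1 : Tendsto substitution (𝓝[>] 0) (𝓝 ((halfValue * 0) ^ 3)) :=
      ((tendsto_realWp.inv_tendsto_atTop).const_mul halfValue).pow 3
    have h2 : ContinuousWithinAt substitution (Ioi 0) 0 := by
      rw [ContinuousWithinAt, substitution_zero]
      simpa using h1
    have h3 : ContinuousWithinAt substitution (Ici 0) 0 := by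
      rw [← Ioi_insert, continuousWithinAt_insert_self]; exact h2
    exact h3.mono Icc_subset_Ici_self
  · have hx' : x ∈ Ioc (0 : ℝ) (1 / 2) := ⟨h0, hx.2⟩
    exact (((hasDerivAt_realWp h0 (by linarith [hx.2])).continuousAt.inv₀
      (realWp_pos hx').ne').const_mul halfValue |>.pow 3).continuousWithinAt

theorem substitution_pos {x : ℝ} (hx : x ∈ Ioc (0 : ℝ) (1 / 2)) : 0 < substitution x :=
  pow_pos (mul_pos halfValue_pos (inv_pos.2 (realWp_pos hx))) 3

theorem strictMonoOn_substitution : StrictMonoOn substitution (Icc 0 (1 / 2)) := by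
  refine continuousOn_substitution.strictMonoOn_of_injOn_Icc (by norm_num)
    (by rw [substitution_zero, substitution_half]; exact zero_le_one) ?_
  intro x hx y hy h
  rcases hx.1.eq_or_lt with rfl | hx0 <;> rcases hy.1.eq_or_lt with rfl | hy0
  · rfl
  · exact absurd h (by rw [substitution_zero]; exact (substitution_pos ⟨hy0, hy.2⟩).ne)
  · exact absurd h (by rw [substitution_zero]; exact (substitution_pos ⟨hx0, hx.2⟩).ne')
  · refine realWp_injOn ⟨hx0, hx.2⟩ ⟨hy0, hy.2⟩ ?_
    have h1 := (Odd.strictMono_pow (R := ℝ) (n := 3) (by decide)).injective h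
    exact inv_injective (mul_left_cancel₀ halfValue_pos.ne' h1)

theorem image_substitution : substitution '' Ioo 0 (1 / 2) = Ioo 0 1 := by
  have h0 : (0 : ℝ) ∈ Icc (0 : ℝ) (1 / 2) := by norm_num
  have h1 : (1 / 2 : ℝ) ∈ Icc (0 : ℝ) (1 / 2) := by norm_num
  apply Subset.antisymm
  · rintro _ ⟨x, hx, rfl⟩
    have hx' := Ioo_subset_Icc_self hx
    constructor
    · rw [← substitution_zero]; exact strictMonoOn_substitution h0 hx' hx.1
    · rw [← substitution_half]; exact strictMonoOn_substitution hx' h1 hx.2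
  · have := intermediate_value_Ioo (by norm_num : (0 : ℝ) ≤ 1 / 2) continuousOn_substitution
    rwa [substitution_zero, substitution_half] at this

theorem hasDerivAt_substitution {x : ℝ} (hx : x ∈ Ioo (0 : ℝ) (1 / 2)) :
    HasDerivAt substitution (-3 * halfValue ^ 3 * realWp' x / realWp x ^ 4) x := by
  have hp := realWp_pos ⟨hx.1, hx.2.le⟩
  refine ((((hasDerivAt_realWp hx.1 (by linarith [hx.2])).fun_inv hp.ne').const_mul
    halfValue).fun_pow 3).congr_deriv ?_
  push_cast
  field_simp

theorem abs_deriv_substitution_mul {x : ℝ} (hx : x ∈ Ioo (0 : ℝ) (1 / 2)) :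
    |-3 * halfValue ^ 3 * realWp' x / realWp x ^ 4| *
      (substitution x ^ (-(5 / 6) : ℝ) * (1 - substitution x) ^ (-(1 / 2) : ℝ)) =
      6 * √halfValue := by
  have hE := halfValue_pos
  have hp := realWp_pos ⟨hx.1, hx.2.le⟩
  have hv : substitution x ∈ Ioo (0 : ℝ) 1 := image_substitution ▸ mem_image_of_mem _ hx
  have hv1 : 0 < 1 - substitution x := sub_pos.2 hv.2
  have hq : 0 < halfValue * (realWp x)⁻¹ := mul_pos hE (inv_pos.2 hp)
  have h1 : (substitution x ^ (-(5 / 6) : ℝ)) ^ 2 = ((halfValue * (realWp x)⁻¹) ^ 5)⁻¹ := by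
    rw [substitution, ← Real.rpow_natCast _ 3, ← Real.rpow_mul hq.le,
      ← Real.rpow_natCast _ 2, ← Real.rpow_mul hq.le, ← Real.rpow_natCast _ 5,
      ← Real.rpow_neg hq.le]
    norm_num
  have h2 : ((1 - substitution x) ^ (-(1 / 2) : ℝ)) ^ 2 = (1 - substitution x)⁻¹ := by
    rw [← Real.rpow_natCast _ 2, ← Real.rpow_mul hv1.le, ← Real.rpow_neg_one]
    norm_num
  have h3 := realWp'_sq hx.1 (by linarith [hx.2])
  have h4 : 1 - substitution x = (realWp x ^ 3 - halfValue ^ 3) / realWp x ^ 3 := by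
    rw [substitution]; field_simp
  have h5 : realWp x ^ 3 - halfValue ^ 3 ≠ 0 := by
    intro h0
    rw [h4, h0, zero_div] at hv1
    exact lt_irrefl _ hv1
  -- Squaring removes the fractional powers and allows `℘'² = 4(℘³ - E³)` to be inserted.
  refine (pow_left_inj₀ (mul_nonneg (abs_nonneg _) (mul_nonneg (Real.rpow_nonneg hv.1.le _)
    (Real.rpow_nonneg hv1.le _))) (by positivity) two_ne_zero).1 ?_
  rw [mul_pow, mul_pow, mul_pow, h1, h2, sq_abs, Real.sq_sqrt hE.le, div_pow, mul_pow, h3, h4]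
  field_simp
  norm_num

/-- Under `v = (E/℘(s))³` the beta integrand becomes the constant `6√E` on an interval of length
`1/2`, half of the real period `1`. -/
theorem betaIntegral_sixth_half :
    Complex.betaIntegral (1 / 6) (1 / 2) = ((3 * √halfValue : ℝ) : ℂ) := by
  have h1 := MeasureTheory.integral_image_eq_integral_abs_deriv_smul
    (measurableSet_Ioo (a := (0 : ℝ)) (b := 1 / 2))
    (fun x hx => (hasDerivAt_substitution hx).hasDerivWithinAt)
    (strictMonoOn_substitution.injOn.mono Ioo_subset_Icc_self)
    (fun v : ℝ => v ^ (-(5 / 6) : ℝ) * (1 - v) ^ (-(1 / 2) : ℝ))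
  have h0 : ∀ x ∈ Ioo (0 : ℝ) (1 / 2), |-3 * halfValue ^ 3 * realWp' x / realWp x ^ 4| •
      (substitution x ^ (-(5 / 6) : ℝ) * (1 - substitution x) ^ (-(1 / 2) : ℝ)) =
      6 * √halfValue := fun x hx => abs_deriv_substitution_mul hx
  rw [image_substitution, MeasureTheory.setIntegral_congr_fun measurableSet_Ioo h0,
    MeasureTheory.setIntegral_const] at h1
  have h2 : ∫ v in Ioo (0 : ℝ) 1, v ^ (-(5 / 6) : ℝ) * (1 - v) ^ (-(1 / 2) : ℝ) =
      3 * √halfValue := by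
    rw [h1]
    simp
    ring
  rw [← h2, ← integral_complex_ofReal, Complex.betaIntegral, intervalIntegral.integral_of_le zero_le_one,
    MeasureTheory.integral_Ioc_eq_integral_Ioo]
  refine MeasureTheory.setIntegral_congr_fun measurableSet_Ioo fun x hx => ?_
  have hx1 : (0 : ℝ) ≤ 1 - x := by linarith [hx.2]
  rw [ofReal_mul, Complex.ofReal_cpow hx.1.le, Complex.ofReal_cpow hx1]
  push_cast
  norm_num

/-- The value `B(1/3, 1/6)` as a real number. -/
def betaValue : ℝ := Real.Gamma (1 / 3) * Real.Gamma (1 / 6) / √Real.pi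

theorem betaIntegral_third_sixth : Complex.betaIntegral (1 / 3) (1 / 6) = (betaValue : ℂ) := by
  have h := Complex.Gamma_mul_Gamma_eq_betaIntegral (s := 1 / 3) (t := 1 / 6)
    (by norm_num) (by norm_num)
  have h2 : Complex.Gamma (1 / 3 + 1 / 6) = ((√Real.pi : ℝ) : ℂ) := by
    rw [← Real.Gamma_one_half_eq, ← Complex.Gamma_ofReal]; norm_num
  have h0 : ((√Real.pi : ℝ) : ℂ) ≠ 0 := ofReal_ne_zero.2 (Real.sqrt_pos.2 Real.pi_pos).ne'
  rw [h2] at h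
  rw [betaValue]
  push_cast
  rw [← Complex.Gamma_ofReal, ← Complex.Gamma_ofReal, eq_div_iff h0]
  push_cast
  rw [h]; ring

theorem betaValue_pos : 0 < betaValue :=
  div_pos (mul_pos (Real.Gamma_pos_of_pos (by norm_num)) (Real.Gamma_pos_of_pos (by norm_num)))
    (Real.sqrt_pos.2 Real.pi_pos)

theorem sqrt_halfValue_mul :
    Real.Gamma (2 / 3) * (3 * √halfValue) = Real.Gamma (1 / 6) * √Real.pi := by
  have h := Complex.Gamma_mul_Gamma_eq_betaIntegral (s := 1 / 6) (t := 1 / 2)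
    (by norm_num) (by norm_num)
  rw [betaIntegral_sixth_half] at h
  rw [← Real.Gamma_one_half_eq]
  apply ofReal_injective
  push_cast at h ⊢
  rw [← Complex.Gamma_ofReal, ← Complex.Gamma_ofReal, ← Complex.Gamma_ofReal]
  push_cast
  rw [h]
  norm_num

theorem Gamma_third_mul_Gamma_two_thirds :
    Real.Gamma (1 / 3) * Real.Gamma (2 / 3) = 2 * Real.pi / √3 := by
  have h := Real.Gamma_mul_Gamma_one_sub (1 / 3)
  rw [show (1 : ℝ) - 1 / 3 = 2 / 3 by norm_num, show Real.pi * (1 / 3) = Real.pi / 3 by ring,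
    Real.sin_pi_div_three] at h
  rw [h]
  field_simp

/-- The evaluation of `B(1/6, 1/2)` combined with the reflection formula at `1/3`. -/
theorem betaValue_sq : betaValue ^ 2 = 12 * halfValue := by
  have h1 := congrArg (· ^ 2) sqrt_halfValue_mul
  have h2 := congrArg (· ^ 2) Gamma_third_mul_Gamma_two_thirds
  simp only [mul_pow, div_pow] at h1 h2
  rw [Real.sq_sqrt halfValue_pos.le, Real.sq_sqrt Real.pi_pos.le] at h1
  rw [Real.sq_sqrt (by norm_num)] at h2
  have hpi := Real.pi_pos
  rw [betaValue, div_pow, mul_pow, Real.sq_sqrt hpi.le, div_eq_iff hpi.ne']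
  have h3 : Real.pi ≠ 0 := hpi.ne'
  apply mul_right_cancel₀ h3
  linear_combination (-Real.Gamma (1 / 3) ^ 2) * h1 + 9 * halfValue * h2

/-- Legendre's duplication formula at `1/6` removes `Γ(1/6)`, and reflection at `1/3` removes
`Γ(2/3)`. -/
theorem betaValue_eq :
    betaValue = (2 : ℝ) ^ (2 / 3 : ℝ) * √3 * Real.Gamma (1 / 3) ^ 3 / (2 * Real.pi) := by
  have h1 := Real.Gamma_mul_Gamma_add_half (1 / 6)
  rw [show (1 / 6 : ℝ) + 1 / 2 = 2 / 3 by norm_num, show (2 : ℝ) * (1 / 6) = 1 / 3 by norm_num,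
    show (1 : ℝ) - 1 / 3 = 2 / 3 by norm_num] at h1
  have h2 := Gamma_third_mul_Gamma_two_thirds
  have hs : √Real.pi ≠ 0 := (Real.sqrt_pos.2 Real.pi_pos).ne'
  have h3 : √(3 : ℝ) ≠ 0 := by positivity
  have hG : Real.Gamma (2 / 3) ≠ 0 := (Real.Gamma_pos_of_pos (by norm_num)).ne'
  have hpi := Real.pi_pos.ne'
  rw [eq_div_iff h3] at h2
  rw [betaValue, div_eq_div_iff hs (by positivity), ← h2]
  linear_combination (Real.Gamma (1 / 3) ^ 2 * √3) * h1

/-- Both sides are positive and their 24th powers agree: `g₃ = 4E³` and `E = B²/12` turn the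
discriminant formula into one in `B¹²`. -/
theorem norm_theta_zeta_eq : ‖theta 0 0 0 zeta‖ =
    (3 : ℝ) ^ (1 / 8 : ℝ) / ((4 : ℝ) ^ (1 / 3 : ℝ) * Real.pi) *
      Real.Gamma (1 / 3) ^ (3 / 2 : ℝ) := by
  have hG : 0 < Real.Gamma (1 / 3) := Real.Gamma_pos_of_pos (by norm_num)
  have hpi := Real.pi_pos
  have key : ∀ (a : ℝ) (p : ℝ) (n : ℕ), 0 ≤ a → p * 24 = n → (a ^ p) ^ 24 = a ^ n := by
    intro a p n ha hp
    rw [← Real.rpow_natCast _ 24, ← Real.rpow_mul ha, ← Real.rpow_natCast]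
    congr 1
  have hb : betaValue ^ 12 = 2 ^ 8 * 3 ^ 6 * Real.Gamma (1 / 3) ^ 36 / (2 * Real.pi) ^ 12 := by
    refine (pow_left_inj₀ (by positivity) (by positivity) two_ne_zero).1 ?_
    rw [betaValue_eq, ← pow_mul, div_pow, mul_pow, mul_pow, key 2 _ 16 (by norm_num) (by norm_num),
      show √(3 : ℝ) ^ (12 * 2) = (√3 ^ 2) ^ 12 by ring, Real.sq_sqrt (by norm_num)]
    ring
  refine (pow_left_inj₀ (norm_nonneg _) (by positivity) (by norm_num : 24 ≠ 0)).1 ?_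
  have hE : halfValue = betaValue ^ 2 / 12 := by rw [betaValue_sq]; ring
  have hE6 : (4 * halfValue ^ 3) ^ 2 = 16 * betaValue ^ 12 / 12 ^ 6 := by rw [hE]; ring
  rw [norm_theta_zeta_pow_eq, g₃_eq, norm_real, Real.norm_eq_abs, sq_abs, hE6, hb,
    mul_pow (_ / _), div_pow (_ ^ _), mul_pow (_ ^ _), key 3 _ 3 (by norm_num) (by norm_num), key 4 _ 8 (by norm_num) (by norm_num),
    key _ _ 36 hG.le (by norm_num)]
  field_simp
  norm_num

/-- The normalizing constant `(1 - ζ²) B(1/3, 1/6)`. -/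
theorem period_eq : (1 - zeta ^ 2) * Complex.betaIntegral (1 / 3) (1 / 6) =
    e (-1 / 8) * (2 * Real.pi) * ((27 : ℝ) ^ (1 / 4 : ℝ) : ℝ) * theta 0 0 0 zeta ^ 2 := by
  have hpi := Real.pi_pos
  have h1 : √3 * betaValue = 2 * Real.pi * (27 : ℝ) ^ (1 / 4 : ℝ) * ‖theta 0 0 0 zeta‖ ^ 2 := by
    have hb := betaValue_pos
    refine (pow_left_inj₀ (by positivity) (by positivity) (by norm_num : 12 ≠ 0)).1 ?_
    have h27 : ((27 : ℝ) ^ (1 / 4 : ℝ)) ^ 12 = 27 ^ 3 := by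
      rw [← Real.rpow_natCast _ 12, ← Real.rpow_mul (by norm_num), ← Real.rpow_natCast _ 3]
      norm_num
    rw [mul_pow, mul_pow, mul_pow, h27, ← pow_mul, norm_theta_zeta_pow_eq, g₃_eq, norm_real,
      Real.norm_eq_abs, sq_abs, show betaValue ^ 12 = (betaValue ^ 2) ^ 6 by ring, betaValue_sq,
      show √(3 : ℝ) ^ 12 = (√3 ^ 2) ^ 6 by ring, Real.sq_sqrt (by norm_num)]
    field_simp
    ring
  have h2 : 1 - zeta ^ 2 = √3 * e (-1 / 12) := by
    have h3 : e (-1 / 12) = √3 / 2 - I / 2 := by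
      rw [e, show 2 * (Real.pi : ℂ) * I * (-1 / 12) = ((-(Real.pi / 6) : ℝ) : ℂ) * I by
        push_cast; ring, Complex.exp_mul_I, ← ofReal_cos, ← ofReal_sin, Real.cos_neg, Real.sin_neg,
        Real.cos_pi_div_six, Real.sin_pi_div_six]
      push_cast; ring
    have h4 : ((√3 : ℝ) : ℂ) ^ 2 = 3 := by
      rw [← ofReal_pow, Real.sq_sqrt (by norm_num)]; norm_num
    rw [zeta_sq, h3, zeta]
    linear_combination (-1 / 2 : ℂ) * h4
  -- The phase `-1/12` of `1 - ζ²` is `-1/8` plus twice the phase `1/48` of `θ_{0,0}(0, ζ)`.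
  have h5 : e (-1 / 8) * e (1 / 48) ^ 2 = e (-1 / 12) := by
    rw [e_pow, ← e_add]; norm_num
  rw [betaIntegral_third_sixth, h2, theta_zeta_zero_zero]
  rw [mul_pow, ← h5]
  have h6 := congrArg (fun x : ℝ => (x : ℂ)) h1
  push_cast at h6
  linear_combination (e (-1 / 8) * e (1 / 48) ^ 2) * h6

end ZetaCurve

namespace ZetaCurve

open Complex Filter PeriodPair

/-! ### The uniformization of the curve by the Weierstrass function -/

local notation "Λ" => PeriodPair.lattice periodPair
local notation "℘" => PeriodPair.weierstrassP periodPair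
local notation "℘₁" => PeriodPair.derivWeierstrassP periodPair

/-- The period `(1 - ζ²) B(1/3, 1/6)` of the form `ψ`. -/
def period : ℂ := (1 - zeta ^ 2) * Complex.betaIntegral (1 / 3) (1 / 6)

/-- This relation is what gives the constant term `1` in `y² = x³ + 1` for `x = 36℘/ω²` and `y =
-108℘'/ω³`. -/
theorem period_pow_six : period ^ 6 = -(36 * (halfValue : ℂ)) ^ 3 := by
  have h1 : (1 - zeta ^ 2) ^ 6 = -27 := by
    have h2 : (1 - zeta ^ 2) ^ 2 = 3 - 3 * zeta := by
      linear_combination (zeta ^ 2 + zeta - 2) * zeta_sq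
    have h3 : (1 - zeta) ^ 3 = -1 := by
      linear_combination (2 - zeta) * zeta_sq
    calc (1 - zeta ^ 2) ^ 6 = ((1 - zeta ^ 2) ^ 2) ^ 3 := by ring
      _ = 27 * (1 - zeta) ^ 3 := by rw [h2]; ring
      _ = -27 := by rw [h3]; ring
  have h4 : (betaValue : ℂ) ^ 2 = 12 * halfValue := by
    exact_mod_cast congrArg (fun x : ℝ => (x : ℂ)) betaValue_sq
  rw [period, betaIntegral_third_sixth, mul_pow, h1,
    show (betaValue : ℂ) ^ 6 = ((betaValue : ℂ) ^ 2) ^ 3 by ring, h4]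
  ring

theorem period_ne_zero : period ≠ 0 := by
  intro h
  have h1 := period_pow_six
  have h2 : (halfValue : ℂ) ≠ 0 := ofReal_ne_zero.2 halfValue_pos.ne'
  rw [h, zero_pow (by norm_num), eq_comm, neg_eq_zero] at h1
  exact pow_ne_zero 3 (mul_ne_zero (by norm_num) h2) h1

/-- The coordinate `x` of the uniformization. -/
def coordX (z : ℂ) : ℂ := 36 / period ^ 2 * ℘ z

/-- The coordinate `y` of the uniformization. -/
def coordY (z : ℂ) : ℂ := -108 / period ^ 3 * ℘₁ z

theorem coordY_sq {z : ℂ} (hz : z ∉ Λ) : coordY z ^ 2 = coordX z ^ 3 + 1 := by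
  have h := wp'_sq hz
  have hp := period_ne_zero
  rw [g₃_eq] at h
  push_cast at h
  rw [coordX, coordY, mul_pow, h]
  field_simp
  rw [period_pow_six]
  ring

theorem coordX_eq_iff {z w : ℂ} : coordX z = coordX w ↔ ℘ z = ℘ w :=
  mul_right_inj' (div_ne_zero (by norm_num) (pow_ne_zero 2 period_ne_zero))

theorem coordY_eq_iff {z w : ℂ} : coordY z = coordY w ↔ ℘₁ z = ℘₁ w :=
  mul_right_inj' (div_ne_zero (by norm_num) (pow_ne_zero 3 period_ne_zero))

theorem coordX_eq_zero_iff {z : ℂ} : coordX z = 0 ↔ ℘ z = 0 :=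
  mul_eq_zero_iff_left (div_ne_zero (by norm_num) (pow_ne_zero 2 period_ne_zero))

theorem coordY_eq_zero_iff {z : ℂ} : coordY z = 0 ↔ ℘₁ z = 0 :=
  mul_eq_zero_iff_left (div_ne_zero (by norm_num) (pow_ne_zero 3 period_ne_zero))

open Classical in
/-- The uniformization of the curve by the complex plane. -/
def uniformization (z : ℂ) : Curve :=
  if h : z ∉ Λ then ((⟨(coordX z, coordY z), coordY_sq h⟩ : AffineModel) : Curve)
  else OnePoint.infty

theorem uniformization_of_mem {z : ℂ} (hz : z ∈ Λ) : uniformization z = OnePoint.infty :=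
  dif_neg (not_not.2 hz)

theorem uniformization_of_notMem {z : ℂ} (hz : z ∉ Λ) :
    uniformization z = ((⟨(coordX z, coordY z), coordY_sq hz⟩ : AffineModel) : Curve) :=
  dif_pos hz

theorem uniformization_add (z : ℂ) {l : ℂ} (hl : l ∈ Λ) :
    uniformization (z + l) = uniformization z := by
  have h1 : z + l ∈ Λ ↔ z ∈ Λ := Submodule.add_mem_iff_left _ hl
  have h2 : ℘ (z + l) = ℘ z := periodPair.weierstrassP_add_coe z ⟨l, hl⟩
  have h3 : ℘₁ (z + l) = ℘₁ z := periodPair.derivWeierstrassP_add_coe z ⟨l, hl⟩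
  by_cases hz : z ∈ Λ
  · rw [uniformization_of_mem hz, uniformization_of_mem (h1.2 hz)]
  · rw [uniformization_of_notMem hz, uniformization_of_notMem (mt h1.1 hz)]
    simp only [coordX, coordY, h2, h3]

theorem hasDerivAt_coordX {z : ℂ} (hz : z ∉ Λ) :
    HasDerivAt coordX (36 / period ^ 2 * ℘₁ z) z :=
  (hasDerivAt_wp hz).const_mul _

theorem hasDerivAt_coordY {z : ℂ} (hz : z ∉ Λ) :
    HasDerivAt coordY (-108 / period ^ 3 * (6 * ℘ z ^ 2)) z :=
  (hasDerivAt_wp' hz).const_mul _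

theorem continuous_uniformization : Continuous uniformization := by
  rw [continuous_iff_continuousAt]
  intro z
  by_cases hz : z ∈ Λ
  · rw [continuousAt_iff_punctured_nhds, uniformization_of_mem hz,
      OnePoint.hasBasis_nhds_infty.tendsto_right_iff]
    rintro s ⟨-, hs⟩
    obtain ⟨M, hM⟩ :=
      (hs.image (f := fun p : AffineModel => p.1.1) (by fun_prop)).isBounded.exists_norm_le
    -- Near a lattice point `x` tends to infinity, while it is bounded on any compact part of the
    -- affine curve.
    have h1 : Tendsto coordX (𝓝[≠] z) (Bornology.cobounded ℂ) :=
      (tendsto_mul_left_cobounded (div_ne_zero (by norm_num)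
        (pow_ne_zero 2 period_ne_zero))).comp (tendsto_wp hz)
    filter_upwards [eventually_notMem_lattice z,
      (tendsto_norm_cobounded_atTop.comp h1).eventually_gt_atTop M] with w hw hw'
    rw [uniformization_of_notMem hw]
    exact Or.inl (mem_image_of_mem _ fun hmem => not_lt.2 (hM _ (mem_image_of_mem _ hmem)) hw')
  · refine ContinuousOn.continuousAt (s := (Λ : Set ℂ)ᶜ) ?_ (isOpen_compl_lattice.mem_nhds hz)
    rw [continuousOn_iff_continuous_domRestrict]
    have h1 : Continuous fun w : ((Λ : Set ℂ)ᶜ : Set ℂ) => (coordX w, coordY w) := by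
      refine Continuous.prodMk ?_ ?_ <;> rw [continuous_iff_continuousAt] <;> intro w
      · exact (hasDerivAt_coordX w.2).continuousAt.comp continuous_subtype_val.continuousAt
      · exact (hasDerivAt_coordY w.2).continuousAt.comp continuous_subtype_val.continuousAt
    refine (OnePoint.continuous_coe.comp
      (h1.subtype_mk fun w => coordY_sq w.2)).congr fun w => ?_
    exact (uniformization_of_notMem w.2).symm

/-- The map from the torus to the curve induced by the uniformization. -/
def torusMap (x : Torus) : Curve :=
  Quotient.liftOn' x uniformization fun a b h => by
    rw [QuotientAddGroup.leftRel_apply, mem_lattice_iff] at h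
    have := uniformization_add a h
    rw [add_neg_cancel_left] at this
    exact this.symm

theorem torusMap_mk (z : ℂ) : torusMap (QuotientAddGroup.mk z) = uniformization z := rfl

theorem continuous_torusMap : Continuous torusMap :=
  (QuotientAddGroup.isOpenQuotientMap_mk (N := lattice)).isQuotientMap.continuous_iff.2
    continuous_uniformization

theorem torus_mk_eq_iff {z w : ℂ} :
    (QuotientAddGroup.mk z : Torus) = QuotientAddGroup.mk w ↔ w - z ∈ Λ := by
  rw [QuotientAddGroup.eq, mem_lattice_iff, neg_add_eq_sub]

theorem injective_torusMap : Function.Injective torusMap := by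
  intro x y
  obtain ⟨z, rfl⟩ := QuotientAddGroup.mk_surjective x
  obtain ⟨w, rfl⟩ := QuotientAddGroup.mk_surjective y
  rw [torusMap_mk, torusMap_mk, torus_mk_eq_iff]
  intro h
  by_cases hz : z ∈ Λ <;> by_cases hw : w ∈ Λ
  · exact sub_mem hw hz
  · rw [uniformization_of_mem hz, uniformization_of_notMem hw] at h
    exact absurd h (OnePoint.infty_ne_coe _)
  · rw [uniformization_of_notMem hz, uniformization_of_mem hw] at h
    exact absurd h (OnePoint.coe_ne_infty _)
  · rw [uniformization_of_notMem hz, uniformization_of_notMem hw, OnePoint.coe_eq_coe,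
      Subtype.mk.injEq, Prod.mk.injEq, coordX_eq_iff, coordY_eq_iff] at h
    exact sub_mem_of_wp_eq hz hw h.1 h.2

theorem surjective_uniformization : Function.Surjective uniformization := by
  intro P
  induction P using OnePoint.rec with
  | infty => exact ⟨0, uniformization_of_mem (zero_mem _)⟩
  | coe p =>
    obtain ⟨⟨x, y⟩, hp⟩ := p
    obtain ⟨z, hz, hx⟩ := exists_wp_eq (x / (36 / period ^ 2))
    have hX : coordX z = x := by
      rw [coordX, hx, mul_div_cancel₀ _
        (div_ne_zero (by norm_num) (pow_ne_zero 2 period_ne_zero))]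
    have hY := coordY_sq hz
    rw [hX, ← show y ^ 2 = x ^ 3 + 1 from hp] at hY
    rcases sq_eq_sq_iff_eq_or_eq_neg.1 hY with h | h
    · refine ⟨z, ?_⟩
      rw [uniformization_of_notMem hz, OnePoint.coe_eq_coe, Subtype.mk.injEq, hX, h]
    · have hz' : -z ∉ Λ := fun hm => hz (by simpa using neg_mem hm)
      refine ⟨-z, ?_⟩
      have hX' : coordX (-z) = x := by rw [← hX, coordX_eq_iff, periodPair.weierstrassP_neg]
      have hY' : coordY (-z) = y := by
        rw [coordY, periodPair.derivWeierstrassP_neg, mul_neg, ← coordY, h, neg_neg]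
      rw [uniformization_of_notMem hz', OnePoint.coe_eq_coe, Subtype.mk.injEq, hX', hY']

theorem bijective_torusMap : Function.Bijective torusMap :=
  ⟨injective_torusMap, fun P => by
    obtain ⟨z, hz⟩ := surjective_uniformization P
    exact ⟨QuotientAddGroup.mk z, hz⟩⟩

instance : CompactSpace Torus := by
  refine ⟨?_⟩
  have h := IsZLattice.isCompact_range_of_periodic Λ (fun z : ℂ => (QuotientAddGroup.mk z : Torus))
    QuotientAddGroup.continuous_mk (fun z w hw => by
      rw [torus_mk_eq_iff]; simpa using hw)
  rwa [range_eq_univ.2 QuotientAddGroup.mk_surjective] at h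

/-- This makes the one-point compactification Hausdorff, so that a continuous bijection from the
compact torus is a homeomorphism. -/
instance : LocallyCompactSpace AffineModel := by
  have h : IsClosed {p : ℂ × ℂ | p.2 ^ 2 = p.1 ^ 3 + 1} :=
    isClosed_eq (by fun_prop) (by fun_prop)
  exact h.isClosedEmbedding_subtypeVal.locallyCompactSpace

/-- The uniformization as a homeomorphism from the torus to the curve. -/
def torusHomeomorph : Torus ≃ₜ Curve :=
  Continuous.homeoOfEquivCompactToT2 (f := Equiv.ofBijective torusMap bijective_torusMap)
    continuous_torusMap

theorem torusHomeomorph_mk (z : ℂ) :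
    torusHomeomorph (QuotientAddGroup.mk z) = uniformization z := rfl

/-! ### The pull-back of the form -/

theorem uniformization_notMem_ramification_iff {z : ℂ} :
    uniformization z ∉ ramification ↔ z ∉ Λ ∧ coordX z ≠ 0 ∧ coordY z ≠ 0 := by
  constructor
  · intro h
    have hz : z ∉ Λ := fun hz => h (Or.inl (uniformization_of_mem hz))
    rw [uniformization_of_notMem hz] at h
    exact ⟨hz, fun h0 => h (Or.inr ⟨_, rfl, Or.inl h0⟩), fun h0 => h (Or.inr ⟨_, rfl, Or.inr h0⟩)⟩
  · rintro ⟨hz, hX, hY⟩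
    rw [uniformization_of_notMem hz]
    rintro (h | ⟨p, hp, h⟩)
    · exact OnePoint.coe_ne_infty _ h
    · rw [OnePoint.coe_eq_coe] at hp
      subst hp
      exact h.elim hX hY

theorem t_uniformization {z : ℂ} (hz : z ∉ Λ) :
    t (uniformization z) = coordY z ^ 2 / coordX z ^ 3 := by
  rw [uniformization_of_notMem hz]; rfl

theorem u_uniformization {z : ℂ} (hz : z ∉ Λ) :
    u (uniformization z) = coordY z / coordX z ^ 2 := by
  rw [uniformization_of_notMem hz]; rfl

theorem eventually_uniformization_notMem_ramification {z : ℂ}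
    (hz : uniformization z ∉ ramification) :
    ∀ᶠ w in 𝓝 z, uniformization w ∉ ramification := by
  simp only [uniformization_notMem_ramification_iff] at *
  have h : ∀ᶠ w in 𝓝 z, w ∉ Λ := isOpen_compl_lattice.mem_nhds hz.1
  exact h.and (((hasDerivAt_coordX hz.1).continuousAt.eventually_ne hz.2.1).and
      ((hasDerivAt_coordY hz.1).continuousAt.eventually_ne hz.2.2))

/-- The values of `t`, `t - 1`, `u` at an unramified point. -/
theorem coordinates_ne_zero {z : ℂ} (hz : uniformization z ∉ ramification) :
    t (uniformization z) ≠ 0 ∧ t (uniformization z) - 1 ≠ 0 ∧ u (uniformization z) ≠ 0 := by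
  obtain ⟨h, hX, hY⟩ := uniformization_notMem_ramification_iff.1 hz
  rw [t_uniformization h, u_uniformization h]
  refine ⟨div_ne_zero (pow_ne_zero 2 hY) (pow_ne_zero 3 hX), ?_,
    div_ne_zero hY (pow_ne_zero 2 hX)⟩
  have : coordY z ^ 2 / coordX z ^ 3 - 1 = (coordX z ^ 3)⁻¹ := by
    rw [coordY_sq h]; field_simp; ring
  rw [this]
  exact inv_ne_zero (pow_ne_zero 3 hX)

theorem differentiableAt_t {z : ℂ} (hz : uniformization z ∉ ramification) :
    DifferentiableAt ℂ (fun w => t (uniformization w)) z := by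
  obtain ⟨h, hX, hY⟩ := uniformization_notMem_ramification_iff.1 hz
  have h1 : DifferentiableAt ℂ (fun w => coordY w ^ 2 / coordX w ^ 3) z :=
    ((hasDerivAt_coordY h).differentiableAt.fun_pow 2).fun_div
      ((hasDerivAt_coordX h).differentiableAt.fun_pow 3) (pow_ne_zero 3 hX)
  refine h1.congr_of_eventuallyEq ?_
  filter_upwards [isOpen_compl_lattice.mem_nhds h] with w hw using t_uniformization hw

theorem differentiableAt_u {z : ℂ} (hz : uniformization z ∉ ramification) :
    DifferentiableAt ℂ (fun w => u (uniformization w)) z := by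
  obtain ⟨h, hX, hY⟩ := uniformization_notMem_ramification_iff.1 hz
  have h1 : DifferentiableAt ℂ (fun w => coordY w / coordX w ^ 2) z :=
    (hasDerivAt_coordY h).differentiableAt.fun_div
      ((hasDerivAt_coordX h).differentiableAt.fun_pow 2) (pow_ne_zero 2 hX)
  refine h1.congr_of_eventuallyEq ?_
  filter_upwards [isOpen_compl_lattice.mem_nhds h] with w hw using u_uniformization hw

theorem contDiffAt_t {z : ℂ} (hz : uniformization z ∉ ramification) :
    ContDiffAt ℂ 1 (fun w => t (uniformization w)) z :=
  (analyticAt_iff_eventually_differentiableAt.2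
    ((eventually_uniformization_notMem_ramification hz).mono
      fun _ hw => differentiableAt_t hw)).contDiffAt

/-- On the curve `t = 1 + x⁻³`, so `ψ = u dt/(t(t-1)) = -3 dx/y`. The scaling of `coordX` and
`coordY` gives `x' = -ωy/3`, hence `ψ = ω dz`. -/
theorem hasDerivAt_t {z : ℂ} (hz : uniformization z ∉ ramification) :
    HasDerivAt (fun w => t (uniformization w)) (period * (t (uniformization z) *
      (t (uniformization z) - 1)) / u (uniformization z)) z := by
  obtain ⟨h, hX, hY⟩ := uniformization_notMem_ramification_iff.1 hz
  have hp := period_ne_zero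
  have h0 : ∀ w, w ∉ Λ → coordX w ≠ 0 → t (uniformization w) = 1 + (coordX w ^ 3)⁻¹ := by
    intro w hw hw'
    rw [t_uniformization hw, coordY_sq hw]; field_simp
  have h1 := (((hasDerivAt_coordX h).fun_pow 3).fun_inv (pow_ne_zero 3 hX)).const_add 1
  have h2 := h1.congr_of_eventuallyEq (f₁ := fun w => t (uniformization w)) (by
    filter_upwards [isOpen_compl_lattice.mem_nhds h,
      (hasDerivAt_coordX h).continuousAt.eventually_ne hX] with w hw hw' using h0 w hw hw')
  refine h2.congr_deriv ?_
  have h3 : 36 / period ^ 2 * ℘₁ z = -period / 3 * coordY z := by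
    rw [coordY]; field_simp; ring
  rw [h3, show t (uniformization z) - 1 = (coordX z ^ 3)⁻¹ by rw [h0 z h hX]; ring,
    t_uniformization h, u_uniformization h]
  push_cast
  field_simp

theorem psiAlong_uniformization {z : ℂ} (hz : uniformization z ∉ ramification) :
    psiAlong uniformization z = period := by
  obtain ⟨h1, h2, h3⟩ := coordinates_ne_zero hz
  rw [psiAlong, (hasDerivAt_t hz).deriv]
  field_simp

/-! ### Paths of integration -/

theorem psiAlong_comp {w : ℝ → ℂ} {w' : ℂ} {s : ℝ} (hw : HasDerivAt w w' s)
    (hs : uniformization (w s) ∉ ramification) :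
    psiAlong (fun r => uniformization (w r)) s = period * w' := by
  obtain ⟨h1, h2, h3⟩ := coordinates_ne_zero hs
  have h := (HasDerivAt.comp s (hasDerivAt_t hs) hw).deriv
  simp only [Function.comp_def] at h
  rw [psiAlong, h]
  field_simp

/-- Points with `y = 0` satisfy `-z ≡ z` and points with `x = 0` satisfy `ζ²z ≡ z` modulo `Λ`, so
all lie in preimages of the lattice under multiplication by nonzero numbers. -/
theorem countable_ramification : {z : ℂ | uniformization z ∈ ramification}.Countable := by
  have h2 : zeta ^ 2 - 1 ≠ 0 := fun h0 => by
    have := congrArg Complex.im (zeta_sq.symm.trans (sub_eq_zero.1 h0))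
    simp [zeta_im_pos.ne'] at this
  have hc : ∀ a : ℂ, a ≠ 0 → ((fun z : ℂ => a * z) ⁻¹' (Λ : Set ℂ)).Countable := fun a ha =>
    countable_lattice.preimage (mul_right_injective₀ ha)
  refine (countable_lattice.union ((hc (-2) (by norm_num)).union (hc _ h2))).mono ?_
  intro z hz
  by_contra hn
  simp only [mem_union, not_or] at hn
  obtain ⟨h0, hn1, hn2⟩ := hn
  refine absurd hz (uniformization_notMem_ramification_iff.2
    ⟨h0, fun hX => hn2 ?_, fun hY => hn1 ?_⟩)
  · rw [coordX_eq_zero_iff] at hX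
    have hz2 : zeta * (zeta * z) ∉ Λ := fun hm => h0 (by
      have := zeta_inv_mul_mem (zeta_inv_mul_mem hm)
      rwa [inv_mul_cancel_left₀ zeta_ne_zero, inv_mul_cancel_left₀ zeta_ne_zero] at this)
    have hm := sub_mem_of_wp_eq h0 hz2 (by rw [wp_zeta_mul, wp_zeta_mul, hX]; simp)
      (by rw [wp'_zeta_mul, wp'_zeta_mul, neg_neg])
    have he : zeta * (zeta * z) - z = (zeta ^ 2 - 1) * z := by ring
    rw [he] at hm
    exact hm
  · rw [coordY_eq_zero_iff] at hY
    have hm := sub_mem_of_wp_eq h0 (fun hm => h0 (by simpa using neg_mem hm) : -z ∉ Λ)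
      (periodPair.weierstrassP_neg z).symm (by rw [periodPair.derivWeierstrassP_neg, hY, neg_zero])
    have he : -z - z = -2 * z := by ring
    rw [he] at hm
    exact hm

/-- Two points of the plane can be joined by a parabola which avoids a given countable set. -/
theorem exists_parabola_avoiding {R : Set ℂ} (hR : R.Countable) {w : ℂ} (hw : w ≠ 0) :
    ∃ k : ℝ, ∀ s ∈ Ioo (0 : ℝ) 1, w * (s + (k * (s * (1 - s)) : ℝ) * I) ∉ R := by
  -- A point `r` on the open parabola determines its parameter `k` by this quotient, so only
  -- countably many `k` are excluded.
  have hc : ((fun r : ℂ => (r / w).im / ((r / w).re * (1 - (r / w).re))) '' R).Countable :=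
    hR.image _
  obtain ⟨k, hk⟩ : ∃ k : ℝ,
      k ∉ (fun r : ℂ => (r / w).im / ((r / w).re * (1 - (r / w).re))) '' R := by
    by_contra! hall
    exact Cardinal.not_countable_real (by rwa [eq_univ_of_forall hall] at hc)
  refine ⟨k, fun s hs hm => hk ⟨_, hm, ?_⟩⟩
  have h1 : w * (s + (k * (s * (1 - s)) : ℝ) * I) / w = s + (k * (s * (1 - s)) : ℝ) * I :=
    mul_div_cancel_left₀ _ hw
  have h2 : s * (1 - s) ≠ 0 := mul_ne_zero hs.1.ne' (sub_pos.2 hs.2).ne'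
  have hre : ((s : ℂ) + (k * (s * (1 - s)) : ℝ) * I).re = s := by
    rw [add_re, ofReal_re, re_ofReal_mul, I_re, mul_zero, add_zero]
  have him : ((s : ℂ) + (k * (s * (1 - s)) : ℝ) * I).im = k * (s * (1 - s)) := by
    rw [add_im, ofReal_im, im_ofReal_mul, I_im, mul_one, zero_add]
  simp only [h1, hre, him]
  exact mul_div_cancel_right₀ _ h2

theorem nonempty_pathTo (P : Curve) : Nonempty (PathTo P) := by
  -- The end point must be nonzero for the parabola to be nonconstant; for `P₁` the period `1`
  -- replaces `0`, which gives a loop.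
  obtain ⟨w, hw, rfl⟩ : ∃ w : ℂ, w ≠ 0 ∧ uniformization w = P := by
    obtain ⟨w, rfl⟩ := surjective_uniformization P
    rcases eq_or_ne w 0 with rfl | hw
    · refine ⟨1, one_ne_zero, ?_⟩
      rw [uniformization_of_mem (zero_mem _),
        uniformization_of_mem (mem_periodPair_lattice.2 ⟨0, 1, by simp⟩)]
    · exact ⟨w, hw, rfl⟩
  obtain ⟨k, hk⟩ := exists_parabola_avoiding countable_ramification hw
  set f : ℝ → ℂ := fun s => w * (s + (k * (s * (1 - s)) : ℝ) * I) with hf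
  have hfc : ContDiff ℝ 1 f := by
    have h1 : ContDiff ℝ 1 (fun s : ℝ => (s : ℂ)) := ofRealCLM.contDiff
    have h2 : ContDiff ℝ 1 (fun s : ℝ => ((k * (s * (1 - s)) : ℝ) : ℂ)) :=
      ofRealCLM.contDiff.comp
        (contDiff_const.mul (contDiff_id.mul (contDiff_const.sub contDiff_id)))
    exact contDiff_const.mul (h1.add (h2.mul contDiff_const))
  have hd : ∀ s, HasDerivAt f (deriv f s) s := fun s =>
    (hfc.differentiable one_ne_zero s).hasDerivAt
  have hk' : ∀ s ∈ Ioo (0 : ℝ) 1, uniformization (f s) ∉ ramification := hk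
  refine ⟨⟨fun s => uniformization (f s),
    (continuous_uniformization.comp hfc.continuous).continuousOn, ?_, ?_, hk', ?_, ?_⟩⟩
  · exact uniformization_of_mem (by simp [hf])
  · simp [hf]
  · intro s hs
    exact (((contDiffAt_t (hk' s hs)).restrict_scalars ℝ).comp s
      hfc.contDiffAt).contDiffWithinAt
  · have h1 : IntervalIntegrable (fun s => period * deriv f s) MeasureTheory.volume 0 1 :=
      (continuous_const.mul (hfc.continuous_deriv le_rfl)).intervalIntegrable 0 1
    refine h1.congr_uIoo fun s hs => ?_
    rw [uIoo_of_le zero_le_one] at hs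
    exact (psiAlong_comp (hd s) (hk' s hs)).symm

theorem isCoveringMap_torus_mk : IsCoveringMap (QuotientAddGroup.mk : ℂ → Torus) := by
  have h : (lattice : Set ℂ) = Λ := by ext x; exact mem_lattice_iff
  refine (AddSubgroup.isAddQuotientCoveringMap_of_comm lattice ?_).isCoveringMap
  rw [h]
  exact ⟨inferInstanceAs (DiscreteTopology Λ)⟩

/-- The derivative of a continuous lift of a path, in terms of the form. -/
theorem hasDerivAt_lift {γ : ℝ → Curve} {w : ℝ → ℂ} {s : ℝ} (hw : ContinuousAt w s)
    (hγ : ∀ᶠ r in 𝓝 s, uniformization (w r) = γ r) (hs : γ s ∉ ramification)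
    (hd : DifferentiableAt ℝ (fun r => t (γ r)) s) :
    HasDerivAt w (psiAlong γ s / period) s := by
  have hs0 : uniformization (w s) = γ s := hγ.self_of_nhds
  have hs' : uniformization (w s) ∉ ramification := by rwa [hs0]
  obtain ⟨h1, h2, h3⟩ := coordinates_ne_zero hs'
  have hp := period_ne_zero
  -- At an unramified point `t` is a local coordinate on the uniformizing plane, so the continuous
  -- lift is locally the inverse of `t` applied to `t ∘ γ`, hence differentiable.
  have hstrict := (contDiffAt_t hs').hasStrictDerivAt' (hasDerivAt_t hs') one_ne_zero
  have hne : period * (t (uniformization (w s)) * (t (uniformization (w s)) - 1)) /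
      u (uniformization (w s)) ≠ 0 := div_ne_zero (mul_ne_zero hp (mul_ne_zero h1 h2)) h3
  have hg : HasDerivAt (fun r => t (uniformization (w r))) (deriv (fun r => t (γ r)) s) s :=
    hd.hasDerivAt.congr_of_eventuallyEq (hγ.mono fun r hr => congrArg t hr)
  have hinv := HasDerivAt.comp s (hstrict.to_localInverse hne).hasDerivAt hg
  have hev := hw.eventually (hstrict.eventually_left_inverse hne)
  refine (hinv.congr_of_eventuallyEq (hev.mono fun r hr => hr.symm)).congr_deriv ?_
  rw [psiAlong, ← hs0]
  field_simp

/-- The path, viewed on the torus, lifts through the covering to a path in `ℂ` from `0` with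
derivative `psiAlong c.γ s / ω`. By the fundamental theorem of calculus the integral is the end
point of the lift, whose class depends only on `P`. -/
theorem mk_integral {P : Curve} (c : PathTo P) :
    (QuotientAddGroup.mk c.integral : Torus) = torusHomeomorph.symm P := by
  have hp := period_ne_zero
  have hδ : Continuous fun s : unitInterval => torusHomeomorph.symm (c.γ s) :=
    torusHomeomorph.symm.continuous.comp (continuousOn_iff_continuous_domRestrict.1 c.continuousOn)
  have h0 : torusHomeomorph.symm P₁ = (QuotientAddGroup.mk (0 : ℂ) : Torus) := by
    rw [Homeomorph.symm_apply_eq, torusHomeomorph_mk, uniformization_of_mem (zero_mem _)]; rfl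
  obtain ⟨W, hW, hW0⟩ := isCoveringMap_torus_mk.exists_path_lifts ⟨_, hδ⟩ 0
    (by simp [c.source, h0])
  set w : ℝ → ℂ := fun s => W (projIcc 0 1 zero_le_one s) with hw_def
  have hwc : Continuous w := W.continuous.comp continuous_projIcc
  have hw : ∀ s ∈ Icc (0 : ℝ) 1, (QuotientAddGroup.mk (w s) : Torus) =
      torusHomeomorph.symm (c.γ s) := by
    intro s hs
    have := congrFun hW ⟨s, hs⟩
    simpa [hw_def, projIcc_of_mem zero_le_one hs] using this
  have hw' : ∀ s ∈ Icc (0 : ℝ) 1, uniformization (w s) = c.γ s := by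
    intro s hs
    rw [← torusHomeomorph_mk, hw s hs, Homeomorph.apply_symm_apply]
  have hd : ∀ s ∈ Ioo (0 : ℝ) 1, HasDerivAt w (psiAlong c.γ s / period) s := by
    intro s hs
    have hn := Ioo_mem_nhds hs.1 hs.2
    refine hasDerivAt_lift hwc.continuousAt ?_ (c.unramified s hs)
      ((c.contDiffOn.contDiffAt hn).differentiableAt one_ne_zero)
    filter_upwards [hn] with r hr using hw' r (Ioo_subset_Icc_self hr)
  have hint := intervalIntegral.integral_eq_sub_of_hasDerivAt_of_le zero_le_one hwc.continuousOn
    hd (c.integrable.div_const period)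
  have hw0 : w 0 = 0 := by
    rw [hw_def, ← hW0]; simp
  rw [intervalIntegral.integral_div, hw0, sub_zero] at hint
  rw [PathTo.integral, ← period, hint, hw 1 ⟨zero_le_one, le_rfl⟩, c.target]

theorem abelJacobi_eq (P : Curve) : abelJacobi P = torusHomeomorph.symm P := by
  rw [abelJacobi, dif_pos (nonempty_pathTo P), mk_integral]

end ZetaCurve

end

/-! ### The main theorem -/

theorem mainTheorem10 :
    -- the Abel-Jacobi map is well defined: paths exist, and the class of the integral
    -- does not depend on the path
    (∀ P : ZetaCurve.Curve, Nonempty (ZetaCurve.PathTo P) ∧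
      ∀ c : ZetaCurve.PathTo P,
        ZetaCurve.abelJacobi P = (QuotientAddGroup.mk c.integral : ZetaCurve.Torus)) ∧
    -- it has an inverse `Φ`, a homeomorphism, holomorphic in the coordinates `t, u` off the
    -- finitely many ramification points, and `Φ^* ψ` is the stated constant times `dz`
    (∃ Φ : ZetaCurve.Torus ≃ₜ ZetaCurve.Curve,
      (∀ P : ZetaCurve.Curve, Φ.symm P = ZetaCurve.abelJacobi P) ∧
      ∀ z : ℂ, Φ (QuotientAddGroup.mk z) ∉ ZetaCurve.ramification →
        DifferentiableAt ℂ (fun w : ℂ => ZetaCurve.t (Φ (QuotientAddGroup.mk w))) z ∧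
        DifferentiableAt ℂ (fun w : ℂ => ZetaCurve.u (Φ (QuotientAddGroup.mk w))) z ∧
        ZetaCurve.psiAlong (fun w : ℂ => Φ (QuotientAddGroup.mk w)) z =
          ZetaCurve.e (-1 / 8) * (2 * Real.pi) * ((27 : ℝ) ^ (1 / 4 : ℝ) : ℝ) *
            ZetaCurve.theta 0 0 0 ZetaCurve.zeta ^ 2) ∧
    -- the values of the theta constants
    ZetaCurve.theta 0 0 0 ZetaCurve.zeta =
      ZetaCurve.e (1 / 48) * ((3 : ℝ) ^ (1 / 8 : ℝ) / ((4 : ℝ) ^ (1 / 3 : ℝ) * Real.pi) *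
        Real.Gamma (1 / 3) ^ (3 / 2 : ℝ) : ℝ) ∧
    ZetaCurve.theta 0 (1 / 2) 0 ZetaCurve.zeta =
      ZetaCurve.e (-1 / 48) * ((3 : ℝ) ^ (1 / 8 : ℝ) / ((4 : ℝ) ^ (1 / 3 : ℝ) * Real.pi) *
        Real.Gamma (1 / 3) ^ (3 / 2 : ℝ) : ℝ) ∧
    ZetaCurve.theta (1 / 2) 0 0 ZetaCurve.zeta =
      ZetaCurve.e (1 / 16) * ((3 : ℝ) ^ (1 / 8 : ℝ) / ((4 : ℝ) ^ (1 / 3 : ℝ) * Real.pi) *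
        Real.Gamma (1 / 3) ^ (3 / 2 : ℝ) : ℝ) ∧
    ZetaCurve.theta (1 / 3) (1 / 3) 0 ZetaCurve.zeta =
      ZetaCurve.e (11 / 144) * ((3 : ℝ) ^ (1 / 8 : ℝ) / (2 * Real.pi) *
        Real.Gamma (1 / 3) ^ (3 / 2 : ℝ) : ℝ) ∧
    ZetaCurve.theta (1 / 6) (1 / 6) 0 ZetaCurve.zeta =
      ZetaCurve.e (5 / 144) * ((27 : ℝ) ^ (1 / 8 : ℝ) / (2 * Real.pi) *
        Real.Gamma (1 / 3) ^ (3 / 2 : ℝ) : ℝ) ∧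
    ZetaCurve.theta (5 / 6) (1 / 3) 0 ZetaCurve.zeta =
      ZetaCurve.e (-7 / 144) * ((3 : ℝ) ^ (1 / 8 : ℝ) / (2 * Real.pi) *
        Real.Gamma (1 / 3) ^ (3 / 2 : ℝ) : ℝ) ∧
    ZetaCurve.theta (1 / 3) (5 / 6) 0 ZetaCurve.zeta =
      ZetaCurve.e (53 / 144) * ((3 : ℝ) ^ (1 / 8 : ℝ) / (2 * Real.pi) *
        Real.Gamma (1 / 3) ^ (3 / 2 : ℝ) : ℝ) := by
  open ZetaCurve in
  exact ⟨fun P => ⟨nonempty_pathTo P, fun c => by rw [abelJacobi_eq, mk_integral]⟩,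
    ⟨torusHomeomorph, fun P => (abelJacobi_eq P).symm, fun z hz =>
      ⟨differentiableAt_t hz, differentiableAt_u hz,
        (psiAlong_uniformization hz).trans period_eq⟩⟩,
    theta_zeta_values norm_theta_zeta_eq⟩
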